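/- A proper cone in $\mathbb{R}^n$ is a closed convex cone $K \subseteq \mathbb{R}^n$ with $K \cap (-K) = \{0\}$ and nonempty interior. An extreme ray of $K$ is a face of $K$ of the form $\{\lambda x : \lambda \ge 0\}$ with $x \ne 0$. For integers $3 \le n \le m$, let $\mathcal{P}(m,n)$ be the set of all $n$-dimensional polyhedral cones with $m$ extreme rays, that is, of all proper cones in $\mathbb{R}^n$ having exactly $m$ extreme rays. A real $n \times n$ matrix $A$ is called $K$-primitive if $AK \subseteq K$ and there is a positive integer $p$ such that $A^p(K \setminus \{0\}) \subseteq \operatorname{int} K$; the smallest such $p$ is the exponent $\gamma(A)$ of $A$. Let $\gamma(K)$ be the maximum of $\gamma(A)$ over all $K$-primitive matrices $A$ (with $\gamma(K) = \infty$ if these exponents are unbounded). Theorem. For all integers $3 \le n \le m$, the maximum $\max\{\gamma(K) : K \in \mathcal{P}(m,n)\}$ exists and is finite. It equals $(n-1)(m-1)+1$ when $m$ is even or when $m$ and $n$ are both odd. When $m$ is odd and $n$ is even, it is at least $(n-1)(m-1)$ and at most $(n-1)(m-1)+1$. -/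

import Mathlib

open scoped Matrix

/-- `K` is a proper cone of `ℝⁿ`: a convex cone (containing `0`) that is closed, pointed
(`K ∩ -K = {0}`) and full (nonempty interior).  The topology of `Fin n → ℝ` is the usual topology
of `ℝⁿ`. -/
structure IsFullProperCone {n : ℕ} (K : PointedCone ℝ (Fin n → ℝ)) : Prop where
  isClosed : IsClosed (K : Set (Fin n → ℝ))
  pointed : ∀ x ∈ K, -x ∈ K → x = 0
  full : (interior (K : Set (Fin n → ℝ))).Nonempty

/-- The extreme rays of `K`: the faces of `K` of the form `{t • x | t ≥ 0}` with `x ≠ 0`. -/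
def extremeRays {n : ℕ} (K : PointedCone ℝ (Fin n → ℝ)) : Set (PointedCone ℝ (Fin n → ℝ)) :=
  {F | F.IsFaceOf K ∧ ∃ x : Fin n → ℝ, x ≠ 0 ∧ (F : Set (Fin n → ℝ)) = {y | ∃ t : ℝ, 0 ≤ t ∧ y = t • x}}

/-- The set `𝒫(m, n)` of all `n`-dimensional polyhedral cones with `m` extreme rays: the proper
cones of `ℝⁿ` with exactly `m` extreme rays. -/
def polyhedralCones (m n : ℕ) : Set (PointedCone ℝ (Fin n → ℝ)) :=
  {K | IsFullProperCone K ∧ (extremeRays K).encard = m}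

/-- `A` is `K`-nonnegative: `A K ⊆ K`. -/
def IsKNonneg {n : ℕ} (K : PointedCone ℝ (Fin n → ℝ)) (A : Matrix (Fin n) (Fin n) ℝ) : Prop :=
  ∀ x ∈ K, A *ᵥ x ∈ K

/-- `A` is `K`-positive: `A (K \ {0}) ⊆ int K`. -/
def IsKPositive {n : ℕ} (K : PointedCone ℝ (Fin n → ℝ)) (A : Matrix (Fin n) (Fin n) ℝ) : Prop :=
  ∀ x ∈ K, x ≠ 0 → A *ᵥ x ∈ interior (K : Set (Fin n → ℝ))

/-- `A` is `K`-primitive: `A` is `K`-nonnegative and some positive power of `A` is `K`-positive. -/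
def IsKPrimitive {n : ℕ} (K : PointedCone ℝ (Fin n → ℝ)) (A : Matrix (Fin n) (Fin n) ℝ) : Prop :=
  IsKNonneg K A ∧ ∃ p : ℕ, 0 < p ∧ IsKPositive K (A ^ p)

/-- The exponent `γ_K(A)` of a `K`-primitive matrix `A`: the smallest positive integer `p` for
which `A ^ p` is `K`-positive. -/
noncomputable def matrixExponent {n : ℕ} (K : PointedCone ℝ (Fin n → ℝ))
    (A : Matrix (Fin n) (Fin n) ℝ) : ℕ :=
  sInf {p : ℕ | 0 < p ∧ IsKPositive K (A ^ p)}

/-- The exponent `γ(K)` of the cone `K`: the largest exponent of a `K`-primitive matrix.  It is an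
extended natural number, equal to `⊤` exactly when the exponents of `K`-primitive matrices are
unbounded; when it is finite and a `K`-primitive matrix exists, the supremum is attained. -/
noncomputable def coneExponent {n : ℕ} (K : PointedCone ℝ (Fin n → ℝ)) : ℕ∞ :=
  ⨆ (A : Matrix (Fin n) (Fin n) ℝ) (_ : IsKPrimitive K A), (matrixExponent K A : ℕ∞)

/-! Upper bound. Say that `y` dominates `z` when `y - δ z ∈ K` for some `δ > 0`, and join an extreme
ray `F` to `G` when the image under `A` of a generator of `F` dominates one of `G`. A walk from `F`
either reaches, after `t` steps, a circuit of length `l < m` with `t + l ≤ m`, or else successors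
are unique everywhere (`exists_short_circuit_or_functional`). The second case makes `A` carry rays
to rays, so no power is positive. In the first, `A ^ l x` dominates `x` for some generator `x`, and
Cayley–Hamilton puts `A ^ (l (n - 1)) x` in the interior
(`IsKPrimitive.pow_mul_mulVec_mem_interior`). Altogether `t + l (n - 1) ≤ m + (m - 1) (n - 2) = (n -
1) (m - 1) + 1` steps suffice.

Lower bound. In an `n`-dimensional commutative algebra, let `a` satisfy `a ^ m = β a + α` and
multiply by `a` on a cone spanned essentially by `1, a, …, a ^ (m - 1)`: this imitates Wielandt's
digraph, with circuits of lengths `m` and `m - 1`. A functional nonnegative on the cone and zero on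
`n - 1` consecutive powers of `a` stays zero on shorter and shorter windows further along, which
delays positivity (`exists_cone_of_cyclic`). Such data come from perturbing a root of `a ^ M = 1`,
with `M = m` for the sharp value and `M = m - 1` for the value one smaller. At the root itself,
functionals on powers are trigonometric polynomials at the multiples of `2π / M`, and products of
sines have the required sign pattern. When `n` is even an extra coordinate `-1` is adjoined, which
forces `M` to be even. -/

/-! ### Bases and extreme rays of proper cones -/

section ProperCones

variable {n : ℕ} {K : PointedCone ℝ (Fin n → ℝ)}

/-- A proper cone has a linear functional bounded below by a multiple of the norm. -/
theorem IsFullProperCone.exists_posFunctional (hK : IsFullProperCone K) :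
    ∃ (ψ : (Fin n → ℝ) →L[ℝ] ℝ) (u : ℝ), 0 < u ∧ ∀ x ∈ K, u * ‖x‖ ≤ ψ x := by
  set S : Set (Fin n → ℝ) := (K : Set (Fin n → ℝ)) ∩ Metric.sphere 0 1
  have hS : IsCompact S := (isCompact_sphere _ _).inter_left hK.isClosed
  have hKc : Convex ℝ (K : Set (Fin n → ℝ)) := fun x hx y hy a b ha hb _ =>
    K.add_mem (PointedCone.smul_mem K ha hx) (PointedCone.smul_mem K hb hy)
  have hsep : ∀ x ∈ S, ∃ ψ : (Fin n → ℝ) →L[ℝ] ℝ, (∀ y ∈ K, 0 ≤ ψ y) ∧ 0 < ψ x := by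
    rintro x ⟨hx, hx1⟩
    have hnx : -x ∉ (K : Set (Fin n → ℝ)) := fun h => by
      rw [hK.pointed x hx h] at hx1
      simp at hx1
    obtain ⟨f, u, hu, hf⟩ := geometric_hahn_banach_point_closed
      hKc hK.isClosed hnx
    have hu0 : u < 0 := by simpa using hf 0 K.zero_mem
    refine ⟨f, fun y hy => ?_, ?_⟩
    · by_contra! hneg
      have h1 := hf ((u / f y) • y) (PointedCone.smul_mem K (div_pos_of_neg_of_neg hu0 hneg).le hy)
      rw [map_smul, smul_eq_mul, div_mul_cancel₀ _ hneg.ne] at h1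
      exact lt_irrefl _ h1
    · rw [map_neg] at hu
      linarith
  obtain ⟨ψ, hψ0, hψS⟩ : ∃ ψ : (Fin n → ℝ) →L[ℝ] ℝ, (∀ y ∈ K, 0 ≤ ψ y) ∧ ∀ x ∈ S, 0 < ψ x := by
    -- Compactness: a functional positive at one point is positive nearby, and finitely many of them
    -- add up to one positive on all of `S`.
    refine hS.induction_on (p := fun s => ∃ ψ : (Fin n → ℝ) →L[ℝ] ℝ, (∀ y ∈ K, 0 ≤ ψ y) ∧
      ∀ x ∈ s ∩ S, 0 < ψ x) ⟨0, by simp, by simp⟩ ?_ ?_ ?_ |>.imp fun ψ h => ⟨h.1, by simpa using h.2⟩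
    · rintro s t hst ⟨ψ, h1, h2⟩
      exact ⟨ψ, h1, fun x hx => h2 x ⟨hst hx.1, hx.2⟩⟩
    · rintro s t ⟨ψ, h1, h2⟩ ⟨φ, h3, h4⟩
      refine ⟨ψ + φ, fun y hy => add_nonneg (h1 y hy) (h3 y hy), ?_⟩
      rintro x ⟨hx | hx, hxS⟩
      · exact add_pos_of_pos_of_nonneg (h2 x ⟨hx, hxS⟩) (h3 x hxS.1)
      · exact add_pos_of_nonneg_of_pos (h1 x hxS.1) (h4 x ⟨hx, hxS⟩)
    · intro x hx
      obtain ⟨ψ, h1, h2⟩ := hsep x hx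
      exact ⟨{y | 0 < ψ y}, mem_nhdsWithin_of_mem_nhds
        ((isOpen_lt continuous_const ψ.continuous).mem_nhds h2), ψ, h1, fun y hy => hy.1⟩
  obtain ⟨u, hu, hψu⟩ : ∃ u, 0 < u ∧ ∀ x ∈ S, u ≤ ψ x := by
    rcases S.eq_empty_or_nonempty with h | h
    · exact ⟨1, one_pos, by simp [h]⟩
    · obtain ⟨x, hx, hmin⟩ := hS.exists_isMinOn h ψ.continuous.continuousOn
      exact ⟨ψ x, hψS x hx, fun y hy => hmin hy⟩
  refine ⟨ψ, u, hu, fun x hx => ?_⟩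
  rcases eq_or_ne x 0 with rfl | hx0
  · simp
  have hpos : 0 < ‖x‖ := norm_pos_iff.2 hx0
  have := hψu (‖x‖⁻¹ • x)
    ⟨PointedCone.smul_mem K (inv_nonneg.2 hpos.le) hx, by simp [norm_smul, hpos.ne']⟩
  rwa [map_smul, smul_eq_mul, inv_mul_eq_div, le_div_iff₀ hpos] at this

/-- The ray spanned by a vector, as a pointed cone. -/
def rayCone (x : Fin n → ℝ) : PointedCone ℝ (Fin n → ℝ) where
  carrier := {y | ∃ t : ℝ, 0 ≤ t ∧ y = t • x}
  zero_mem' := ⟨0, le_rfl, by simp⟩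
  add_mem' := by
    rintro _ _ ⟨s, hs, rfl⟩ ⟨t, ht, rfl⟩
    exact ⟨s + t, add_nonneg hs ht, by rw [add_smul]⟩
  smul_mem' := by
    rintro c _ ⟨s, hs, rfl⟩
    exact ⟨c * s, mul_nonneg c.2 hs, by rw [mul_smul]; rfl⟩

theorem mem_rayCone {x y : Fin n → ℝ} : y ∈ rayCone x ↔ ∃ t : ℝ, 0 ≤ t ∧ y = t • x := Iff.rfl

/-- The rays through the extreme points of a base of `K` are extreme rays. -/
theorem rayCone_mem_extremeRays {ψ : (Fin n → ℝ) →L[ℝ] ℝ} (hψ : ∀ x ∈ K, x ≠ 0 → 0 < ψ x)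
    {x : Fin n → ℝ} (hx : x ∈ Set.extremePoints ℝ {y | y ∈ K ∧ ψ y = 1}) :
    rayCone x ∈ extremeRays K := by
  obtain ⟨⟨hxK, hx1⟩, hext⟩ := mem_extremePoints.1 hx
  refine ⟨⟨?_, ?_⟩, x, fun h => by simp [h] at hx1, rfl⟩
  · rintro _ ⟨t, ht, rfl⟩
    exact PointedCone.smul_mem K ht hxK
  · rintro y z a hy hz ha ⟨t, ht, h⟩
    rcases eq_or_ne y 0 with rfl | hy0
    · exact zero_mem _
    rcases eq_or_ne z 0 with rfl | hz0
    · refine ⟨a⁻¹ * t, by positivity, ?_⟩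
      rw [mul_smul, ← h, add_zero, inv_smul_smul₀ ha.ne']
    have hp := hψ y hy hy0
    have hq := hψ z hz hz0
    have hsum : a * ψ y + ψ z = t := by
      have := congrArg ψ h
      simpa [hx1] using this
    have ht0 : 0 < t := by rw [← hsum]; positivity
    have hy' : (ψ y)⁻¹ • y ∈ {y | y ∈ K ∧ ψ y = 1} :=
      ⟨PointedCone.smul_mem K (inv_nonneg.2 hp.le) hy, by simp [hp.ne']⟩
    have hz' : (ψ z)⁻¹ • z ∈ {y | y ∈ K ∧ ψ y = 1} :=
      ⟨PointedCone.smul_mem K (inv_nonneg.2 hq.le) hz, by simp [hq.ne']⟩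
    have := (hext _ hy' _ hz' ⟨a * ψ y / t, ψ z / t, by positivity, by positivity, ?_, ?_⟩).1
    · exact ⟨ψ y, hp.le, by rw [← this, smul_inv_smul₀ hp.ne']⟩
    · rw [← add_div, hsum, div_self ht0.ne']
    · rw [smul_smul, smul_smul]
      have e1 : a * ψ y / t * (ψ y)⁻¹ = t⁻¹ * a := by field_simp
      have e2 : ψ z / t * (ψ z)⁻¹ = t⁻¹ := by field_simp
      rw [e1, e2, mul_smul, ← smul_add, h, inv_smul_smul₀ ht0.ne']

/-- A generator of an extreme ray. -/
noncomputable def rayGenerator (F : extremeRays K) : Fin n → ℝ := F.2.2.choose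

theorem rayGenerator_ne_zero (F : extremeRays K) : rayGenerator F ≠ 0 := F.2.2.choose_spec.1

theorem mem_extremeRay_iff (F : extremeRays K) (y : Fin n → ℝ) :
    y ∈ F.1 ↔ ∃ t : ℝ, 0 ≤ t ∧ y = t • rayGenerator F := by
  have := F.2.2.choose_spec.2
  rw [← SetLike.mem_coe, this]
  rfl

theorem rayGenerator_mem_ray (F : extremeRays K) : rayGenerator F ∈ F.1 :=
  (mem_extremeRay_iff F _).2 ⟨1, zero_le_one, by simp⟩

theorem rayGenerator_mem (F : extremeRays K) : rayGenerator F ∈ K :=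
  F.2.1.le (rayGenerator_mem_ray F)

/-- Around an interior `x`, both `x + s w` and `x - s w` lie in `K` and sum to `2 x`; the face
property puts `x + s w` on the ray, so the space would be a line. -/
theorem rayGenerator_notMem_interior (hn : 2 ≤ n) (F : extremeRays K) :
    rayGenerator F ∉ interior (K : Set (Fin n → ℝ)) := by
  intro h
  set x := rayGenerator F with hxdef
  have key : ∀ w : Fin n → ℝ, ∃ t : ℝ, w = t • x := by
    intro w
    have hc : Filter.Tendsto (fun s : ℝ => x + s • w) (nhds 0) (nhds x) := by
      have : Continuous fun s : ℝ => x + s • w := by fun_prop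
      simpa using this.tendsto 0
    have hc' : Filter.Tendsto (fun s : ℝ => x - s • w) (nhds 0) (nhds x) := by
      have : Continuous fun s : ℝ => x - s • w := by fun_prop
      simpa using this.tendsto 0
    have hK := mem_interior_iff_mem_nhds.1 h
    have h3 : ∀ᶠ s : ℝ in nhdsWithin 0 (Set.Ioi 0), 0 < s := self_mem_nhdsWithin
    obtain ⟨s, ⟨hs1, hs2⟩, hs⟩ :=
      (((hc.eventually hK).and (hc'.eventually hK)).filter_mono nhdsWithin_le_nhds |>.and h3).exists
    have hmem : x + s • w ∈ F.1 := by
      refine F.2.1.mem_of_add_mem_left hs1 hs2 ((mem_extremeRay_iff F _).2 ⟨2, by norm_num, ?_⟩)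
      rw [two_smul]; abel
    obtain ⟨t, -, ht⟩ := (mem_extremeRay_iff F _).1 hmem
    refine ⟨s⁻¹ * (t - 1), ?_⟩
    rw [mul_smul, sub_smul, one_smul, ← hxdef] at *
    rw [← ht, add_sub_cancel_left, inv_smul_smul₀ hs.ne']
  have : Module.finrank ℝ (Fin n → ℝ) ≤ 1 := finrank_le_one x fun w => by
    obtain ⟨t, ht⟩ := key w
    exact ⟨t, ht.symm⟩
  simp at this
  omega

/-- A proper cone with finitely many extreme rays is generated by them. -/
theorem IsFullProperCone.exists_eq_sum_rayGenerator (hK : IsFullProperCone K)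
    [Fintype (extremeRays K)] {y : Fin n → ℝ} (hy : y ∈ K) :
    ∃ c : extremeRays K → ℝ, (∀ F, 0 ≤ c F) ∧ y = ∑ F, c F • rayGenerator F := by
  obtain ⟨ψ, u, hu, hψ⟩ := hK.exists_posFunctional
  have hψ' : ∀ x ∈ K, x ≠ 0 → 0 < ψ x := fun x hx hx0 =>
    lt_of_lt_of_le (mul_pos hu (norm_pos_iff.2 hx0)) (hψ x hx)
  set B : Set (Fin n → ℝ) := {y | y ∈ K ∧ ψ y = 1} with hB
  have hBc : IsCompact B := by
    refine Metric.isCompact_of_isClosed_isBounded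
      (hK.isClosed.inter (isClosed_eq ψ.continuous continuous_const)) ?_
    refine (Metric.isBounded_closedBall (x := (0 : Fin n → ℝ)) (r := 1 / u)).subset ?_
    rintro x ⟨hx, hx1⟩
    have := hψ x hx
    rw [mem_closedBall_zero_iff, le_div_iff₀ hu]
    linarith
  have hBconv : Convex ℝ B := by
    rintro x ⟨hx, hx1⟩ y ⟨hy, hy1⟩ a b ha hb hab
    refine ⟨K.add_mem (PointedCone.smul_mem K ha hx) (PointedCone.smul_mem K hb hy), ?_⟩
    simp [hx1, hy1, hab]
  have hfin : (Set.extremePoints ℝ B).Finite := by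
    refine Set.Finite.of_finite_image (f := rayCone)
      ((Set.toFinite (extremeRays K)).subset ?_) ?_
    · rintro _ ⟨x, hx, rfl⟩
      exact rayCone_mem_extremeRays hψ' hx
    · intro x hx x' hx' h
      have h1 : x ∈ rayCone x' := h ▸ mem_rayCone.2 ⟨1, zero_le_one, by simp⟩
      obtain ⟨t, -, ht⟩ := h1
      have e1 := (extremePoints_subset hx).2
      have e2 := (extremePoints_subset hx').2
      have : t = 1 := by simpa [ht, e2] using e1
      simpa [this] using ht
  -- Krein–Milman; the closure is superfluous because the hull of finitely many points is closed.
  have hBeq : B = convexHull ℝ (Set.extremePoints ℝ B) := by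
    conv_lhs => rw [← closure_convexHull_extremePoints hBc hBconv]
    exact hfin.isClosed_convexHull ℝ |>.closure_eq
  rcases eq_or_ne y 0 with rfl | hy0
  · exact ⟨0, by simp, by simp⟩
  have hp := hψ' y hy hy0
  have hyB : (ψ y)⁻¹ • y ∈ B :=
    ⟨PointedCone.smul_mem K (inv_nonneg.2 hp.le) hy, by simp [hp.ne']⟩
  have hsub : B ⊆ {y | ∃ c : extremeRays K → ℝ, (∀ F, 0 ≤ c F) ∧
      y = ∑ F, c F • rayGenerator F} := by
    rw [hBeq]
    refine convexHull_min ?_ ?_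
    · intro x hx
      set F : extremeRays K := ⟨rayCone x, rayCone_mem_extremeRays hψ' hx⟩
      obtain ⟨t, ht, hxt⟩ := (mem_extremeRay_iff F x).1 (mem_rayCone.2 ⟨1, zero_le_one, by simp⟩)
      classical
      refine ⟨Pi.single F t, fun G => ?_, ?_⟩
      · by_cases h : G = F
        · subst h; simpa using ht
        · simp [h]
      · rw [Finset.sum_eq_single F (fun G _ h => by simp [h]) (by simp)]
        simpa using hxt
    · rintro x ⟨c, hc, rfl⟩ y ⟨d, hd, rfl⟩ a b ha hb -
      refine ⟨fun F => a * c F + b * d F, fun F => ?_, ?_⟩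
      · have := hc F; have := hd F; positivity
      · simp [add_smul, mul_smul, Finset.sum_add_distrib, Finset.smul_sum]
  obtain ⟨c, hc, h⟩ := hsub hyB
  refine ⟨fun F => ψ y * c F, fun F => mul_nonneg hp.le (hc F), ?_⟩
  simp_rw [mul_smul]
  rw [← Finset.smul_sum, ← h, smul_inv_smul₀ hp.ne']

/-- A cone generated by finitely many vectors has at most that many extreme rays. -/
theorem encard_extremeRays_le {ι : Type*} [Fintype ι] {X : ι → Fin n → ℝ} (hX : ∀ i, X i ∈ K)
    (hX0 : ∀ i, X i ≠ 0)
    (hgen : ∀ y ∈ K, ∃ c : ι → ℝ, (∀ i, 0 ≤ c i) ∧ y = ∑ i, c i • X i) :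
    (extremeRays K).encard ≤ Fintype.card ι := by
  have h : ∀ F : extremeRays K, ∃ i, X i ∈ F.1 := by
    intro F
    obtain ⟨c, hc, h⟩ := hgen _ (rayGenerator_mem F)
    have : ∃ i, 0 < c i := by
      by_contra! hcon
      have : ∀ i, c i = 0 := fun i => le_antisymm (hcon i) (hc i)
      exact rayGenerator_ne_zero F (by simpa [this] using h)
    obtain ⟨i, hi⟩ := this
    exact ⟨i, F.2.1.mem_of_sum_smul_mem hX hc (h ▸ rayGenerator_mem_ray F) i hi⟩
  choose f hf using h
  have hinj : Function.Injective f := by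
    intro F G hFG
    have key : ∀ F : extremeRays K, F.1 = rayCone (X (f F)) := by
      intro F
      obtain ⟨t, ht, hxt⟩ := (mem_extremeRay_iff F _).1 (hf F)
      have ht0 : t ≠ 0 := by
        rintro rfl
        exact hX0 _ (by simpa using hxt)
      ext y
      rw [mem_extremeRay_iff, mem_rayCone, hxt]
      constructor
      · rintro ⟨s, hs, rfl⟩
        exact ⟨s * t⁻¹, by positivity, by rw [smul_smul]; congr 1; field_simp⟩
      · rintro ⟨s, hs, rfl⟩
        exact ⟨s * t, by positivity, by rw [smul_smul]⟩
    apply Subtype.ext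
    rw [key F, key G, hFG]
  have := ENat.card_le_card_of_injective hinj
  rwa [ENat.card_eq_coe_fintype_card (α := ι)] at this

end ProperCones

/-! ### Domination with respect to a cone, and Cayley–Hamilton -/

section Domination

variable {n : ℕ} {K : PointedCone ℝ (Fin n → ℝ)} {A : Matrix (Fin n) (Fin n) ℝ}
  {x y z w : Fin n → ℝ}

/-- `y` dominates `z` with respect to the cone `K` if `y - δ z ∈ K` for some `δ > 0`. -/
def ConeDominates (K : PointedCone ℝ (Fin n → ℝ)) (y z : Fin n → ℝ) : Prop :=
  ∃ δ : ℝ, 0 < δ ∧ y - δ • z ∈ K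

theorem ConeDominates.refl (y : Fin n → ℝ) : ConeDominates K y y :=
  ⟨1, one_pos, by simp⟩

theorem ConeDominates.trans (h₁ : ConeDominates K x y) (h₂ : ConeDominates K y z) :
    ConeDominates K x z := by
  obtain ⟨a, ha, hxy⟩ := h₁
  obtain ⟨b, hb, hyz⟩ := h₂
  refine ⟨a * b, mul_pos ha hb, ?_⟩
  have := K.add_mem hxy (PointedCone.smul_mem K ha.le hyz)
  rwa [smul_sub, smul_smul, sub_add_sub_cancel] at this

theorem ConeDominates.add (h₁ : ConeDominates K x y) (h₂ : ConeDominates K x z) :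
    ConeDominates K x (y + z) := by
  obtain ⟨a, ha, hy⟩ := h₁
  obtain ⟨b, hb, hz⟩ := h₂
  refine ⟨a * b / (a + b), by positivity, ?_⟩
  have := K.add_mem (PointedCone.smul_mem K (show 0 ≤ b / (a + b) by positivity) hy)
    (PointedCone.smul_mem K (show 0 ≤ a / (a + b) by positivity) hz)
  convert this using 1
  ext i
  simp only [Pi.sub_apply, Pi.smul_apply, Pi.add_apply, smul_eq_mul]
  field_simp
  ring

theorem ConeDominates.smul (hx : x ∈ K) (hy : y ∈ K) (h : ConeDominates K x y) (c : ℝ) :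
    ConeDominates K x (c • y) := by
  rcases le_or_gt c 0 with hc | hc
  · refine ⟨1, one_pos, ?_⟩
    have := K.add_mem hx (PointedCone.smul_mem K (neg_nonneg.2 hc) hy)
    rwa [neg_smul, ← sub_eq_add_neg, ← one_smul ℝ (c • y)] at this
  · obtain ⟨a, ha, h⟩ := h
    exact ⟨a / c, by positivity, by rwa [smul_smul, div_mul_cancel₀ _ hc.ne']⟩

theorem ConeDominates.sum {ι : Type*} (s : Finset ι) {f : ι → Fin n → ℝ} (hx : x ∈ K)
    (h : ∀ i ∈ s, ConeDominates K x (f i)) : ConeDominates K x (∑ i ∈ s, f i) := by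
  classical
  induction s using Finset.induction_on with
  | empty => exact ⟨1, one_pos, by simpa using hx⟩
  | insert i s his ih =>
    rw [Finset.sum_insert his]
    exact (h i (by simp)).add (ih fun j hj => h j (by simp [hj]))

theorem ConeDominates.mulVec (hA : IsKNonneg K A) (h : ConeDominates K x y) :
    ConeDominates K (A *ᵥ x) (A *ᵥ y) := by
  obtain ⟨a, ha, h⟩ := h
  refine ⟨a, ha, ?_⟩
  rw [← Matrix.mulVec_smul, ← Matrix.mulVec_sub]
  exact hA _ h

theorem smul_mem_interior_cone {c : ℝ} (hc : 0 < c) (hx : x ∈ interior (K : Set (Fin n → ℝ))) :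
    c • x ∈ interior (K : Set (Fin n → ℝ)) := by
  have hopen : IsOpen ((fun w : Fin n → ℝ => c⁻¹ • w) ⁻¹' interior (K : Set (Fin n → ℝ))) :=
    isOpen_interior.preimage (continuous_const_smul _)
  refine interior_maximal (fun w hw => ?_) hopen (by simpa [inv_smul_smul₀ hc.ne'] using hx)
  have := PointedCone.smul_mem K hc.le (interior_subset hw)
  rwa [smul_inv_smul₀ hc.ne'] at this

theorem add_mem_interior_cone (hx : x ∈ interior (K : Set (Fin n → ℝ))) (hy : y ∈ K) :
    x + y ∈ interior (K : Set (Fin n → ℝ)) := by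
  have hopen : IsOpen ((fun w : Fin n → ℝ => w - y) ⁻¹' interior (K : Set (Fin n → ℝ))) :=
    isOpen_interior.preimage (by fun_prop)
  refine interior_maximal (fun w hw => ?_) hopen (by simpa using hx)
  have := K.add_mem (interior_subset hw) hy
  rwa [sub_add_cancel] at this

theorem ConeDominates.mem_interior (h : ConeDominates K x y)
    (hy : y ∈ interior (K : Set (Fin n → ℝ))) : x ∈ interior (K : Set (Fin n → ℝ)) := by
  obtain ⟨a, ha, h⟩ := h
  have := add_mem_interior_cone (smul_mem_interior_cone ha hy) h
  rwa [add_sub_cancel] at this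

theorem ConeDominates.of_mem_interior (hx : x ∈ interior (K : Set (Fin n → ℝ)))
    (y : Fin n → ℝ) : ConeDominates K x y := by
  have hc : Filter.Tendsto (fun s : ℝ => x - s • y) (nhds 0) (nhds x) := by
    have : Continuous fun s : ℝ => x - s • y := by fun_prop
    simpa using this.tendsto 0
  have h3 : ∀ᶠ s : ℝ in nhdsWithin 0 (Set.Ioi 0), 0 < s := self_mem_nhdsWithin
  obtain ⟨s, hs1, hs⟩ := (((hc.eventually (mem_interior_iff_mem_nhds.1 hx)).filter_mono
    nhdsWithin_le_nhds).and h3).exists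
  exact ⟨s, hs, hs1⟩

theorem IsKNonneg.pow (hA : IsKNonneg K A) (p : ℕ) : IsKNonneg K (A ^ p) := by
  induction p with
  | zero => intro x hx; simpa using hx
  | succ p ih => intro x hx; rw [pow_succ, ← Matrix.mulVec_mulVec]; exact ih _ (hA _ hx)

/-- An interior `v` dominates everything, in particular `A ^ (p - 1) v`; hence `A v` dominates the
interior point `A ^ p v`. -/
theorem IsKPrimitive.pow_mulVec_mem_interior (hA : IsKPrimitive K A)
    (hx : x ∈ interior (K : Set (Fin n → ℝ))) (k : ℕ) :
    A ^ k *ᵥ x ∈ interior (K : Set (Fin n → ℝ)) := by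
  induction k with
  | zero => simpa using hx
  | succ k ih =>
    set v := A ^ k *ᵥ x with hv
    rw [pow_succ', ← Matrix.mulVec_mulVec, ← hv]
    obtain ⟨p, hp, hpos⟩ := hA.2
    rcases eq_or_ne v 0 with h0 | h0
    · rw [h0, Matrix.mulVec_zero, ← h0]; exact ih
    obtain ⟨q, rfl⟩ : ∃ q, p = q + 1 := ⟨p - 1, by omega⟩
    refine ConeDominates.mem_interior ?_ (hpos v (interior_subset ih) h0)
    rw [pow_succ', ← Matrix.mulVec_mulVec]
    exact (ConeDominates.of_mem_interior ih _).mulVec hA.1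

theorem IsKPrimitive.pow_mulVec_mem_interior_of_le (hA : IsKPrimitive K A) {j k : ℕ} (hjk : j ≤ k)
    (hx : A ^ j *ᵥ x ∈ interior (K : Set (Fin n → ℝ))) :
    A ^ k *ᵥ x ∈ interior (K : Set (Fin n → ℝ)) := by
  have := hA.pow_mulVec_mem_interior hx (k - j)
  rwa [Matrix.mulVec_mulVec, ← pow_add, Nat.sub_add_cancel hjk] at this

/-- With `C = A ^ l`, each `C ^ k x` dominates the earlier ones. By Cayley–Hamilton an interior `C ^
p x` is a combination of `x, …, C ^ (n - 1) x`, hence dominated by `C ^ (n - 1) x`; the signs of the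
coefficients do not matter. -/
theorem IsKPrimitive.pow_mul_mulVec_mem_interior (hA : IsKPrimitive K A) (hx : x ∈ K) (hx0 : x ≠ 0)
    {l : ℕ} (hl : 0 < l) (h : ConeDominates K (A ^ l *ᵥ x) x) :
    A ^ (l * (n - 1)) *ᵥ x ∈ interior (K : Set (Fin n → ℝ)) := by
  have hn : 0 < n := by
    rcases Nat.eq_zero_or_pos n with rfl | hn
    · exact absurd (Subsingleton.elim x 0) hx0
    · exact hn
  set C := A ^ l with hC
  have hCn : IsKNonneg K C := hA.1.pow l
  obtain ⟨p, hp, hpos⟩ := hA.2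
  have hint : C ^ p *ᵥ x ∈ interior (K : Set (Fin n → ℝ)) := by
    rw [hC, ← pow_mul]
    exact hA.pow_mulVec_mem_interior_of_le (Nat.le_mul_of_pos_left p hl) (hpos x hx hx0)
  rw [pow_mul, ← hC]
  refine ConeDominates.mem_interior ?_ hint
  have hdom : ∀ j k, j ≤ k → ConeDominates K (C ^ k *ᵥ x) (C ^ j *ᵥ x) := by
    intro j k hjk
    induction k, hjk using Nat.le_induction with
    | base => exact ConeDominates.refl _
    | succ k _ ih =>
      refine ConeDominates.trans ?_ ih
      have := h.mulVec (hCn.pow k)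
      rwa [Matrix.mulVec_mulVec, ← pow_succ] at this
  rw [Matrix.pow_eq_aeval_mod_charpoly C p, Polynomial.aeval_eq_sum_range' (n := n), Matrix.sum_mulVec]
  · refine ConeDominates.sum _ (hCn.pow _ _ hx) fun i hi => ?_
    rw [Matrix.smul_mulVec]
    exact (hdom i (n - 1) (by have := Finset.mem_range.1 hi; omega)).smul (hCn.pow _ _ hx)
      (hCn.pow _ _ hx) _
  · have hd : C.charpoly.natDegree = n := by simp [Matrix.charpoly_natDegree_eq_dim]
    have := Polynomial.natDegree_modByMonic_lt (Polynomial.X ^ p) C.charpoly_monic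
      (fun h => by rw [h] at hd; simp at hd; omega)
    rwa [hd] at this

end Domination

/-! ### Short circuits in finite relations -/

section Relations

/-- In a relation on a finite type for which every element has a successor, either some walk
from `i` runs into a circuit that does not exhaust the type, or successors are unique. -/
theorem exists_short_circuit_or_functional {ι : Type*} [Fintype ι] (R : ι → ι → Prop)
    (hR : ∀ i, ∃ j, R i j) (i : ι) :
    (∃ (f : ι → ι) (t l : ℕ), (∀ j, R j (f j)) ∧ 0 < l ∧ l < Fintype.card ι ∧
      t + l ≤ Fintype.card ι ∧ f^[t + l] i = f^[t] i) ∨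
    ∃ f : ι → ι, ∀ j k, R j k → k = f j := by
  classical
  by_contra! hcon
  obtain ⟨h1, h2⟩ := hcon
  -- Without a short circuit, the orbit of `i` under any choice `f` of successors is one cycle
  -- through the whole type.
  have hinj : ∀ f : ι → ι, (∀ j, R j (f j)) → Function.Injective f := by
    intro f hf
    have key : ∀ a b, a < b → b ≤ Fintype.card ι → f^[a] i = f^[b] i →
        a = 0 ∧ b = Fintype.card ι := by
      intro a b hab hb he
      by_contra hne
      refine h1 f a (b - a) hf (by omega) (by omega) (by omega) ?_
      rw [Nat.add_sub_cancel' hab.le, he]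
    have hcyc : f^[Fintype.card ι] i = i := by
      obtain ⟨a, b, hne, he⟩ := Fintype.exists_ne_map_eq_of_card_lt
        (fun k : Fin (Fintype.card ι + 1) => f^[k] i) (by simp)
      rcases lt_or_gt_of_ne (fun h => hne (Fin.ext h) : (a : ℕ) ≠ b) with h | h
      · obtain ⟨h3, h4⟩ := key a b h (by omega) he
        simpa [h3, h4] using he.symm
      · obtain ⟨h3, h4⟩ := key b a h (by omega) he.symm
        simpa [h3, h4] using he
    have hbij : Function.Bijective (fun k : Fin (Fintype.card ι) => f^[k] i) := by
      rw [Fintype.bijective_iff_injective_and_card]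
      refine ⟨fun a b he => ?_, by simp⟩
      by_contra hne
      rcases lt_or_gt_of_ne (fun h => hne (Fin.ext h) : (a : ℕ) ≠ b) with h | h
      · have := (key a b h (by omega) he).2; omega
      · have := (key b a h (by omega) he.symm).2; omega
    refine Finite.injective_iff_surjective.2 fun j => ?_
    obtain ⟨⟨k, hk⟩, rfl⟩ := hbij.2 j
    rcases k with _ | k
    · refine ⟨f^[Fintype.card ι - 1] i, ?_⟩
      rw [← Function.iterate_succ_apply' f, Nat.succ_eq_add_one, Nat.sub_add_cancel (by omega)]
      exact hcyc
    · exact ⟨f^[k] i, (Function.iterate_succ_apply' f k i).symm⟩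
  choose f hf using hR
  obtain ⟨j, k, hjk, hne⟩ := h2 f
  have hfi := hinj f hf
  -- A second successor `k` of `j` gives another choice of successors. It must be injective too, yet
  -- it sends both `j` and the old preimage of `k` to `k`.
  have hgi := hinj (Function.update f j k) (fun a => by
    by_cases h : a = j
    · subst h; simpa using hjk
    · simpa [h] using hf a)
  obtain ⟨a, ha⟩ := Finite.injective_iff_surjective.1 hfi k
  have haj : a ≠ j := by rintro rfl; exact hne ha.symm
  exact haj (hgi (by simp [haj, ha]))

end Relations

/-! ### The upper bound -/

section UpperBound

variable {n : ℕ} {K : PointedCone ℝ (Fin n → ℝ)} {A : Matrix (Fin n) (Fin n) ℝ}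

/-- The `(n - 1)(m - 1) + 1`-st power of a primitive matrix is positive, for a proper cone with
`m` extreme rays. -/
theorem IsKPrimitive.isKPositive_pow (hn : 2 ≤ n) (hK : IsFullProperCone K) {m : ℕ}
    (hm : (extremeRays K).encard = m) (hA : IsKPrimitive K A) :
    IsKPositive K (A ^ ((n - 1) * (m - 1) + 1)) := by
  have : Finite (extremeRays K) := Set.finite_of_encard_eq_coe hm
  have := Fintype.ofFinite (extremeRays K)
  have hcard : Fintype.card (extremeRays K) = m := by
    rw [Set.encard, ENat.card_eq_coe_fintype_card] at hm
    exact_mod_cast hm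
  set N := (n - 1) * (m - 1) + 1 with hN
  obtain ⟨p, hp, hpos⟩ := hA.2
  set R : extremeRays K → extremeRays K → Prop := fun F G =>
    ConeDominates K (A *ᵥ rayGenerator F) (rayGenerator G) with hRdef
  have hexp : ∀ F, ∃ c : extremeRays K → ℝ, (∀ G, 0 ≤ c G) ∧
      A *ᵥ rayGenerator F = ∑ G, c G • rayGenerator G ∧ ∀ G, 0 < c G → R F G := by
    intro F
    obtain ⟨c, hc, h⟩ := hK.exists_eq_sum_rayGenerator (hA.1 _ (rayGenerator_mem F))
    refine ⟨c, hc, h, fun G hG => ⟨c G, hG, ?_⟩⟩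
    classical
    rw [h, ← Finset.add_sum_erase _ _ (Finset.mem_univ G), add_sub_cancel_left]
    exact K.sum_mem fun H _ => PointedCone.smul_mem K (hc H) (rayGenerator_mem H)
  have hR : ∀ F, ∃ G, R F G := by
    intro F
    obtain ⟨c, hc, h, hG⟩ := hexp F
    by_contra! hcon
    have hc0 : ∀ G, c G = 0 := fun G =>
      le_antisymm (not_lt.1 fun hlt => hcon G (hG G hlt)) (hc G)
    have h0 : A *ᵥ rayGenerator F = 0 := by simpa [hc0] using h
    have h1 := hpos _ (rayGenerator_mem F) (rayGenerator_ne_zero F)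
    obtain ⟨q, rfl⟩ : ∃ q, p = q + 1 := ⟨p - 1, by omega⟩
    rw [pow_succ, ← Matrix.mulVec_mulVec, h0, Matrix.mulVec_zero] at h1
    have h2 : ConeDominates K (rayGenerator F) (0 : Fin n → ℝ) :=
      ⟨1, one_pos, by simpa using rayGenerator_mem F⟩
    exact rayGenerator_notMem_interior hn F (h2.mem_interior h1)
  have hgen : ∀ F : extremeRays K, A ^ N *ᵥ rayGenerator F ∈ interior (K : Set (Fin n → ℝ)) := by
    intro F
    rcases exists_short_circuit_or_functional R hR F with ⟨f, t, l, hf, hl, hlm, htl, he⟩ | ⟨f, hf⟩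
    · rw [hcard] at hlm htl
      have hwalk : ∀ k G, ConeDominates K (A ^ k *ᵥ rayGenerator G) (rayGenerator (f^[k] G)) := by
        intro k
        induction k with
        | zero => intro G; simpa using ConeDominates.refl _
        | succ k ih =>
          intro G
          rw [pow_succ', ← Matrix.mulVec_mulVec, Function.iterate_succ_apply']
          exact ((ih G).mulVec hA.1).trans (hf _)
      have h1 : ConeDominates K (A ^ l *ᵥ rayGenerator (f^[t] F)) (rayGenerator (f^[t] F)) := by
        have := hwalk l (f^[t] F)
        rwa [← Function.iterate_add_apply, add_comm l t, he] at this
      have h2 := hA.pow_mul_mulVec_mem_interior (rayGenerator_mem _) (rayGenerator_ne_zero _) hl h1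
      have h3 := ((hwalk t F).mulVec (hA.1.pow (l * (n - 1)))).mem_interior h2
      rw [Matrix.mulVec_mulVec, ← pow_add] at h3
      refine hA.pow_mulVec_mem_interior_of_le ?_ h3
      obtain ⟨a, rfl⟩ : ∃ a, n = a + 2 := ⟨n - 2, by omega⟩
      obtain ⟨b, rfl⟩ : ∃ b, m = b + 1 := ⟨m - 1, by omega⟩
      -- Here `a = n - 2` and `b = m - 1`: the count `t + l (a + 1)` is at most `m + l a`, and `l ≤
      -- b`.
      have h4 : l * a ≤ b * a := Nat.mul_le_mul_right a (by omega)
      have e1 : a + 2 - 1 = a + 1 := rfl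
      have e2 : b + 1 - 1 = b := rfl
      rw [hN, e1, e2]
      nlinarith
    · exfalso
      have hperm : ∀ G, ∃ c : ℝ, A *ᵥ rayGenerator G = c • rayGenerator (f G) := by
        intro G
        obtain ⟨c, hc, h, hG⟩ := hexp G
        refine ⟨c (f G), h.trans (Finset.sum_eq_single _ (fun H _ hH => ?_) (by simp))⟩
        have : c H = 0 := le_antisymm (not_lt.1 fun hlt => hH (hf _ _ (hG H hlt))) (hc H)
        simp [this]
      have hperm' : ∀ k, ∃ (c : ℝ) (G : extremeRays K),
          A ^ k *ᵥ rayGenerator F = c • rayGenerator G := by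
        intro k
        induction k with
        | zero => exact ⟨1, F, by simp⟩
        | succ k ih =>
          obtain ⟨c, G, h⟩ := ih
          obtain ⟨d, hd⟩ := hperm G
          exact ⟨c * d, f G, by
            rw [pow_succ', ← Matrix.mulVec_mulVec, h, Matrix.mulVec_smul, hd, smul_smul]⟩
      obtain ⟨c, G, h⟩ := hperm' p
      have h1 := hpos _ (rayGenerator_mem F) (rayGenerator_ne_zero F)
      rw [h] at h1
      exact rayGenerator_notMem_interior hn G
        (((ConeDominates.refl _).smul (rayGenerator_mem G) (rayGenerator_mem G) c).mem_interior h1)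
  intro x hx hx0
  obtain ⟨c, hc, h⟩ := hK.exists_eq_sum_rayGenerator hx
  obtain ⟨F, hF⟩ : ∃ F, 0 < c F := by
    by_contra! hcon
    have : ∀ F, c F = 0 := fun F => le_antisymm (hcon F) (hc F)
    exact hx0 (by simpa [this] using h)
  have hd : ConeDominates K x (rayGenerator F) := by
    refine ⟨c F, hF, ?_⟩
    classical
    rw [h, ← Finset.add_sum_erase _ _ (Finset.mem_univ F), add_sub_cancel_left]
    exact K.sum_mem fun H _ => PointedCone.smul_mem K (hc H) (rayGenerator_mem H)
  exact (hd.mulVec (hA.1.pow N)).mem_interior (hgen F)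

theorem coneExponent_le (hn : 2 ≤ n) (hK : IsFullProperCone K) {m : ℕ}
    (hm : (extremeRays K).encard = m) : coneExponent K ≤ ((n - 1) * (m - 1) + 1 : ℕ) := by
  refine iSup₂_le fun A hA => ?_
  exact_mod_cast Nat.sInf_le (⟨Nat.succ_pos _, hA.isKPositive_pow hn hK hm⟩ :
    (n - 1) * (m - 1) + 1 ∈ {p : ℕ | 0 < p ∧ IsKPositive K (A ^ p)})

end UpperBound

/-! ### Finitely generated cones -/

section GeneratedCones

variable {n : ℕ} {ι : Type*} [Fintype ι] {v : ι → Fin n → ℝ}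

/-- The cone of nonnegative combinations of a finite family of vectors. -/
def generatedCone (v : ι → Fin n → ℝ) : PointedCone ℝ (Fin n → ℝ) where
  carrier := {y | ∃ c : ι → ℝ, (∀ i, 0 ≤ c i) ∧ y = ∑ i, c i • v i}
  zero_mem' := ⟨0, fun _ => le_rfl, by simp⟩
  add_mem' := by
    rintro _ _ ⟨c, hc, rfl⟩ ⟨d, hd, rfl⟩
    exact ⟨c + d, fun i => add_nonneg (hc i) (hd i), by simp [add_smul, Finset.sum_add_distrib]⟩
  smul_mem' := by
    rintro r _ ⟨c, hc, rfl⟩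
    refine ⟨fun i => r * c i, fun i => mul_nonneg r.2 (hc i), ?_⟩
    simp_rw [mul_smul, ← Finset.smul_sum]
    rfl

theorem generator_mem (i : ι) : v i ∈ generatedCone v := by
  classical
  refine ⟨Pi.single i 1, fun j => ?_, ?_⟩
  · by_cases h : j = i
    · subst h; simp
    · simp [h]
  · rw [Finset.sum_eq_single i (fun j _ h => by simp [h]) (by simp)]
    simp

theorem generatedCone_nonneg {φ : (Fin n → ℝ) →ₗ[ℝ] ℝ} (hφ : ∀ i, 0 ≤ φ (v i)) {y : Fin n → ℝ}
    (hy : y ∈ generatedCone v) : 0 ≤ φ y := by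
  obtain ⟨c, hc, rfl⟩ := hy
  rw [map_sum]
  exact Finset.sum_nonneg fun i _ => by
    rw [map_smul, smul_eq_mul]; exact mul_nonneg (hc i) (hφ i)

theorem exists_dominates_generator {y : Fin n → ℝ} (hy : y ∈ generatedCone v) (hy0 : y ≠ 0) :
    ∃ i, ConeDominates (generatedCone v) y (v i) := by
  classical
  obtain ⟨c, hc, h⟩ := hy
  obtain ⟨i, hi⟩ : ∃ i, 0 < c i := by
    by_contra! hcon
    have : ∀ i, c i = 0 := fun i => le_antisymm (hcon i) (hc i)
    exact hy0 (by simpa [this] using h)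
  refine ⟨i, c i, hi, ?_⟩
  rw [h, ← Finset.add_sum_erase _ _ (Finset.mem_univ i), add_sub_cancel_left]
  exact Submodule.sum_mem _ fun j _ => PointedCone.smul_mem _ (hc j) (generator_mem j)

/-- The map from coefficients to combinations is surjective, hence open, and the all-ones vector
lies in the open positive orthant. -/
theorem sum_generators_mem_interior (hspan : Submodule.span ℝ (Set.range v) = ⊤) :
    ∑ i, v i ∈ interior (generatedCone v : Set (Fin n → ℝ)) := by
  set T : (ι → ℝ) →ₗ[ℝ] (Fin n → ℝ) := Fintype.linearCombination ℝ v with hT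
  have hsurj : Function.Surjective T := by
    rw [← LinearMap.range_eq_top, hT, Fintype.range_linearCombination, hspan]
  have hopen : IsOpenMap T := T.isOpenMap_of_finiteDimensional hsurj
  have hpos : IsOpen {c : ι → ℝ | ∀ i, 0 < c i} := by
    simp only [Set.ofPred_forall]
    exact isOpen_iInter_of_finite fun i => isOpen_lt continuous_const (continuous_apply i)
  refine interior_maximal ?_ (hopen _ hpos) ⟨fun _ => 1, fun _ => one_pos, ?_⟩
  · rintro _ ⟨c, hc, rfl⟩
    exact ⟨c, fun i => (hc i).le, by rw [hT, Fintype.linearCombination_apply]⟩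
  · rw [hT, Fintype.linearCombination_apply]
    simp

/-- A cone generated by finitely many spanning vectors in an open half space is proper. -/
theorem isFullProperCone_generatedCone (hspan : Submodule.span ℝ (Set.range v) = ⊤)
    (φ : (Fin n → ℝ) →ₗ[ℝ] ℝ) (hφ : ∀ i, 0 < φ (v i)) : IsFullProperCone (generatedCone v) where
  isClosed := by
    have hcont : Continuous φ := φ.continuous_of_finiteDimensional
    refine isClosed_of_closure_subset fun y hy => ?_
    set t := φ y + 1
    set P : Set (ι → ℝ) := Set.Icc 0 (fun i => t / φ (v i))
    set f : (ι → ℝ) → Fin n → ℝ := fun c => ∑ i, c i • v i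
    have hP : IsCompact (f '' P) := isCompact_Icc.image (by fun_prop)
    -- Below level `t`, each coefficient is at most `t / φ (v i)`, so this part of the cone lies in
    -- the compact image of a box.
    have hsub : {z | φ z < t} ∩ (generatedCone v : Set (Fin n → ℝ)) ⊆ f '' P := by
      rintro _ ⟨hz, c, hc, rfl⟩
      refine ⟨c, ⟨hc, fun i => ?_⟩, rfl⟩
      rw [le_div_iff₀ (hφ i)]
      refine le_trans ?_ (le_of_lt hz)
      rw [map_sum]
      simp_rw [map_smul, smul_eq_mul]
      exact Finset.single_le_sum (f := fun i => c i * φ (v i))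
        (fun j _ => mul_nonneg (hc j) (hφ j).le) (Finset.mem_univ i)
    have hmem : y ∈ closure ({z | φ z < t} ∩ (generatedCone v : Set (Fin n → ℝ))) :=
      (isOpen_lt hcont continuous_const).inter_closure ⟨lt_add_one (φ y), hy⟩
    obtain ⟨c, hc, rfl⟩ := hP.isClosed.closure_subset_iff.2 hsub hmem
    exact ⟨c, hc.1, rfl⟩
  pointed := by
    rintro x hx hnx
    by_contra hx0
    obtain ⟨i, δ, hδ, h⟩ := exists_dominates_generator hx hx0
    have h1 := generatedCone_nonneg (fun i => (hφ i).le) h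
    have h2 := generatedCone_nonneg (fun i => (hφ i).le) hnx
    rw [map_sub, map_smul, smul_eq_mul] at h1
    rw [map_neg] at h2
    have := mul_pos hδ (hφ i)
    linarith
  full := ⟨_, sum_generators_mem_interior hspan⟩

theorem notMem_interior_of_functional {K : PointedCone ℝ (Fin n → ℝ)} {φ : (Fin n → ℝ) →ₗ[ℝ] ℝ}
    (hφ : ∀ y ∈ K, 0 ≤ φ y) (hφ0 : φ ≠ 0) {x : Fin n → ℝ} (hx : φ x = 0) :
    x ∉ interior (K : Set (Fin n → ℝ)) := by
  intro hint
  have key : ∀ z, φ z ≤ 0 := by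
    intro z
    obtain ⟨δ, hδ, h⟩ := ConeDominates.of_mem_interior hint z
    have := hφ _ h
    rw [map_sub, hx, map_smul, smul_eq_mul] at this
    by_contra! hz
    have := mul_pos hδ hz
    linarith
  refine hφ0 (LinearMap.ext fun z => le_antisymm (key z) ?_)
  have := key (-z)
  rw [map_neg] at this
  simpa using this

end GeneratedCones

/-! ### Cones from multiplication by a root of a trinomial -/

section CyclicCones

/-- The circuit lengths `m` and `m - 1` are coprime, so they generate all large integers. Requiring
`1 ≤ s` ensures that the walk leaves the vertex `1`, which the shorter circuit misses. -/
theorem exists_eq_mul_add_mul_pred {m N : ℕ} (hm : 2 ≤ m) (hN : m * m ≤ N) :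
    ∃ s t, N = s * m + t * (m - 1) ∧ 1 ≤ s := by
  obtain ⟨q, rfl⟩ : ∃ q, m = q + 1 := ⟨m - 1, by omega⟩
  have hq : 0 < q := by omega
  have h1 := Nat.div_add_mod (N - 1) q
  have h2 := Nat.mod_lt (N - 1) hq
  set d := (N - 1) / q
  set r := (N - 1) % q
  have hN' : N = q * d + (r + 1) := by
    have : 0 < N := by nlinarith
    omega
  have hd : r + 1 ≤ d := by
    have : q ≤ d := by
      by_contra! h
      have : q * d ≤ q * q := Nat.mul_le_mul_left q h.le
      nlinarith
    omega
  obtain ⟨t, ht⟩ := Nat.exists_eq_add_of_le hd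
  refine ⟨r + 1, t, ?_, by omega⟩
  rw [hN', ht, Nat.add_sub_cancel]
  ring

variable {R : Type*} [CommRing R] [Algebra ℝ R]

/-- The generators `1, a, …, a ^ (m - 2), a ^ (m - 1) - γ` of a cone in an algebra. -/
def cyclicGenerator (a : R) (m : ℕ) (γ : ℝ) (i : Fin m) : R :=
  a ^ (i : ℕ) - if (i : ℕ) + 1 = m then γ • (1 : R) else 0

/-- The cone spanned by `1, a, …, a ^ (m - 2), a ^ (m - 1) - γ`, where `a ^ m = β a + α`, has
multiplication by `a` as a primitive map of large exponent when there is a functional that is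
nonnegative on the cone and vanishes on `a ^ (e - n + 2), …, a ^ e`. -/
theorem exists_cone_of_cyclic {n m e : ℕ} (hn : 3 ≤ n) (hm : 2 ≤ m)
    (hR : Module.finrank ℝ R = n) (a : R) {α β γ : ℝ} (hα : 0 < α) (hβ : 0 < β) (hγ : 0 ≤ γ)
    (hγβ : γ ≤ β) (ha : a ^ m = β • a + α • 1) (π : R →ₐ[ℝ] ℝ) (hπ : 0 < π a)
    (ψ : R →ₗ[ℝ] ℝ) (hψ0 : ψ ≠ 0) (hψ : ∀ i, i + 1 < m → 0 ≤ ψ (a ^ i))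
    (hψm : γ * ψ 1 ≤ ψ (a ^ (m - 1))) (hwin : ∀ i, e + 2 ≤ i + n → i ≤ e → ψ (a ^ i) = 0)
    (hne : n ≤ e + 1) (hem : m ≤ e + 2)
    (hspan : Submodule.span ℝ ((fun i => a ^ i) '' Set.Iio m) = ⊤) :
    ∃ K ∈ polyhedralCones m n, (((m - 1) * (n - 2) + e + 1 : ℕ) : ℕ∞) ≤ coneExponent K := by
  have hfin : FiniteDimensional ℝ R := FiniteDimensional.of_finrank_pos (by omega)
  set E : R ≃ₗ[ℝ] (Fin n → ℝ) := LinearEquiv.ofFinrankEq R (Fin n → ℝ) (by simp [hR])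
  set X : Fin m → R := cyclicGenerator a m γ with hX
  set v : Fin m → Fin n → ℝ := fun i => E (X i) with hv
  set K := generatedCone v with hK
  set A : Matrix (Fin n) (Fin n) ℝ :=
    LinearMap.toMatrix' (E.toLinearMap ∘ₗ LinearMap.mulLeft ℝ a ∘ₗ E.symm.toLinearMap) with hAdef
  have hA1 : ∀ y, A *ᵥ E y = E (a * y) := by
    intro y
    rw [hAdef, LinearMap.toMatrix'_mulVec]
    simp
  have hApow : ∀ k y, A ^ k *ᵥ E y = E (a ^ k * y) := by
    intro k
    induction k with
    | zero => intro y; simp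
    | succ k ih =>
      intro y
      rw [pow_succ, ← Matrix.mulVec_mulVec, hA1, ih, pow_succ, mul_assoc]
  have hX1 : ∀ i : Fin m, (i : ℕ) + 1 < m → X i = a ^ (i : ℕ) := fun i hi => by
    rw [hX, cyclicGenerator, if_neg hi.ne, sub_zero]
  have hX2 : ∀ i : Fin m, (i : ℕ) + 1 = m → X i = a ^ (m - 1) - γ • 1 := fun i hi => by
    rw [hX, cyclicGenerator, if_pos hi, show (i : ℕ) = m - 1 by omega]
  have h1K : E 1 ∈ K := by
    have : E (X ⟨0, by omega⟩) ∈ K := generator_mem (v := v) ⟨0, by omega⟩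
    rwa [hX1 ⟨0, by omega⟩ (by simp only; omega), pow_zero] at this
  have hpowX : ∀ i (hi : i < m), E (a ^ i) - E (X ⟨i, hi⟩) ∈ K := by
    intro i hi
    rcases Nat.lt_or_ge (i + 1) m with h | h
    · rw [hX1 ⟨i, hi⟩ h, sub_self]; exact K.zero_mem
    · have him : i + 1 = m := by omega
      rw [hX2 ⟨i, hi⟩ him, ← map_sub, show i = m - 1 by omega, sub_sub_cancel, map_smul]
      exact PointedCone.smul_mem K hγ h1K
  have hpow : ∀ i, i < m → E (a ^ i) ∈ K := by
    intro i hi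
    have := K.add_mem (hpowX i hi) (generator_mem (v := v) ⟨i, hi⟩)
    rwa [sub_add_cancel] at this
  have haK : E a ∈ K := by simpa using hpow 1 (by omega)
  have hlast : ∀ i : Fin m, (i : ℕ) + 1 = m → a * X i = (β - γ) • a + α • 1 := by
    intro i hi
    rw [hX2 i hi, mul_sub, ← pow_succ', Nat.sub_add_cancel (by omega), ha, mul_smul_comm, mul_one,
      sub_smul]
    abel
  have hnn : IsKNonneg K A := by
    rintro _ ⟨c, hc, rfl⟩
    rw [Matrix.mulVec_sum]
    refine K.sum_mem fun i _ => ?_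
    rw [Matrix.mulVec_smul, hA1]
    refine PointedCone.smul_mem K (hc i) ?_
    rcases Nat.lt_or_ge ((i : ℕ) + 1) m with h | h
    · rw [hX1 i h, ← pow_succ']; exact hpow _ h
    · rw [hlast i (by omega), map_add, map_smul, map_smul]
      exact K.add_mem (PointedCone.smul_mem K (sub_nonneg.2 hγβ) haK)
        (PointedCone.smul_mem K hα.le h1K)
  have hdmul : ∀ k y z, ConeDominates K (E y) (E z) →
      ConeDominates K (E (a ^ k * y)) (E (a ^ k * z)) := by
    intro k y z h
    have := h.mulVec (hnn.pow k)
    rwa [hApow, hApow] at this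
  have hd1 : ConeDominates K (E (a ^ m)) (E 1) := by
    refine ⟨α, hα, ?_⟩
    rw [ha, map_add, map_smul, map_smul, add_sub_cancel_right]
    exact PointedCone.smul_mem K hβ.le haK
  have hda : ConeDominates K (E (a ^ m)) (E a) := by
    refine ⟨β, hβ, ?_⟩
    rw [ha, map_add, map_smul, map_smul, add_sub_cancel_left]
    exact PointedCone.smul_mem K hα.le h1K
  have hds : ∀ j s, ConeDominates K (E (a ^ (j + s * m))) (E (a ^ j)) := by
    intro j s
    induction s with
    | zero => simpa using ConeDominates.refl _
    | succ s ih =>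
      refine ConeDominates.trans ?_ ih
      have := hdmul (j + s * m) _ _ hd1
      rwa [← pow_add, mul_one, add_assoc, ← Nat.succ_mul] at this
  have hdt : ∀ j t, ConeDominates K (E (a ^ (j + 1 + t * (m - 1)))) (E (a ^ (j + 1))) := by
    intro j t
    induction t with
    | zero => simpa using ConeDominates.refl _
    | succ t ih =>
      refine ConeDominates.trans ?_ ih
      have := hdmul (j + t * (m - 1)) _ _ hda
      rw [← pow_add, ← pow_succ] at this
      have e1 : j + t * (m - 1) + m = j + 1 + (t + 1) * (m - 1) := by
        rw [Nat.succ_mul]; omega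
      have e2 : j + t * (m - 1) + 1 = j + 1 + t * (m - 1) := by omega
      rwa [e1, e2] at this
  have hdN : ∀ j N, m * m ≤ N → ConeDominates K (E (a ^ (j + N))) (E (a ^ j)) := by
    intro j N hN
    obtain ⟨s, t, rfl, hs⟩ := exists_eq_mul_add_mul_pred hm hN
    refine ConeDominates.trans ?_ (hds j s)
    obtain ⟨b, hb⟩ : ∃ b, j + s * m = b + 1 := ⟨j + s * m - 1, by
      have : 0 < s * m := Nat.mul_pos hs (by omega)
      omega⟩
    have := hdt b t
    rwa [← hb, add_assoc] at this
  have hspan' : Submodule.span ℝ (Set.range v) = ⊤ := by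
    have hXs : Submodule.span ℝ (Set.range X) = ⊤ := by
      rw [eq_top_iff, ← hspan, Submodule.span_le]
      rintro _ ⟨i, hi, rfl⟩
      have h1 : (1 : R) ∈ Submodule.span ℝ (Set.range X) :=
        Submodule.subset_span ⟨⟨0, by omega⟩, by
          rw [hX1 ⟨0, by omega⟩ (by simp only; omega)]; simp⟩
      have h2 : X ⟨i, hi⟩ ∈ Submodule.span ℝ (Set.range X) := Submodule.subset_span ⟨_, rfl⟩
      rcases Nat.lt_or_ge (i + 1) m with h | h
      · rwa [hX1 ⟨i, hi⟩ h] at h2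
      · have hi' : i < m := hi
        have him : i + 1 = m := by omega
        rw [hX2 ⟨i, hi⟩ him] at h2
        have := Submodule.add_mem _ h2 (Submodule.smul_mem _ γ h1)
        rw [sub_add_cancel] at this
        simpa [show i = m - 1 by omega] using this
    have : Set.range v = E.toLinearMap '' Set.range X := by
      rw [← Set.range_comp]; rfl
    rw [this, ← Submodule.map_span, hXs, Submodule.map_top, LinearEquiv.range]
  have hint : ∀ i, i < m → E (a ^ (m * m + m + i)) ∈ interior (K : Set (Fin n → ℝ)) := by
    intro i hi
    have hmem : E (a ^ (m * m + m + i)) ∈ K := by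
      have := hnn.pow (m * m + m) _ (hpow i hi)
      rwa [hApow, ← pow_add] at this
    -- The exponent exceeds every `j < m` by at least `m * m`, so this power dominates all
    -- generators at once, hence their interior sum.
    refine ConeDominates.mem_interior (ConeDominates.sum Finset.univ hmem fun j _ => ?_)
      (sum_generators_mem_interior hspan')
    have h1 := hdN j (m * m + m + i - j) (by omega)
    rw [Nat.add_sub_cancel' (by omega)] at h1
    exact h1.trans ⟨1, one_pos, by rw [one_smul]; exact hpowX j j.2⟩
  have hpos : IsKPositive K (A ^ (m * m + m + 1)) := by
    intro x hx hx0
    obtain ⟨i, hi⟩ := exists_dominates_generator hx hx0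
    refine (hi.mulVec (hnn.pow _)).mem_interior ?_
    rw [hv, hApow]
    rcases Nat.lt_or_ge ((i : ℕ) + 1) m with h | h
    · rw [hX1 i h, ← pow_add, add_assoc, add_comm 1]
      exact hint _ h
    · have h0 : ConeDominates K (E (a * X i)) (E 1) := by
        refine ⟨α, hα, ?_⟩
        rw [hlast i (by omega), map_add, map_smul, map_smul, add_sub_cancel_right]
        exact PointedCone.smul_mem K (sub_nonneg.2 hγβ) haK
      have h1 := hdmul (m * m + m) _ _ h0
      rw [← mul_assoc, ← pow_succ, mul_one] at h1
      exact h1.mem_interior (by simpa using hint 0 (by omega))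
  have hprim : IsKPrimitive K A := ⟨hnn, _, Nat.succ_pos _, hpos⟩
  set π' : (Fin n → ℝ) →ₗ[ℝ] ℝ := π.toLinearMap ∘ₗ E.symm.toLinearMap with hπ'
  have hπv : ∀ i, 0 < π' (v i) := by
    intro i
    have e1 : π' (v i) = π (X i) := by simp [hπ', hv]
    rw [e1]
    rcases Nat.lt_or_ge ((i : ℕ) + 1) m with h | h
    · rw [hX1 i h, map_pow]; positivity
    · have h1 := congrArg π (hlast i (by omega))
      simp only [map_mul, map_add, map_smul, map_one, smul_eq_mul, mul_one] at h1
      have h2 : 0 ≤ (β - γ) * π a := mul_nonneg (sub_nonneg.2 hγβ) hπ.le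
      have h3 : 0 < π a * π (X i) := by rw [h1]; linarith
      exact pos_of_mul_pos_right h3 hπ.le
  have hproper : IsFullProperCone K := isFullProperCone_generatedCone hspan' π' hπv
  set ψ' : (Fin n → ℝ) →ₗ[ℝ] ℝ := ψ ∘ₗ E.symm.toLinearMap with hψ'
  have hψ'E : ∀ y, ψ' (E y) = ψ y := fun y => by simp [hψ']
  have hψ'0 : ψ' ≠ 0 := fun h => hψ0 (LinearMap.ext fun y => by rw [← hψ'E, h]; rfl)
  have hψ'K : ∀ y ∈ K, 0 ≤ ψ' y := fun y hy => by
    refine generatedCone_nonneg (fun i => ?_) hy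
    rw [hv, hψ'E]
    rcases Nat.lt_or_ge ((i : ℕ) + 1) m with h | h
    · rw [hX1 i h]; exact hψ _ h
    · rw [hX2 i (by omega), map_sub, map_smul, smul_eq_mul]; linarith
  -- Substituting `a ^ m = β a + α` expresses a value through two adjacent earlier ones, so each
  -- shift by `m - 1` costs one zero at the left end of the window. From `n - 1` zeros, one remains
  -- after `n - 2` shifts.
  have hzero : ∀ k, k ≤ n - 2 → ∀ i, e + 2 + k ≤ i + n → i ≤ e → ψ (a ^ ((m - 1) * k + i)) = 0 := by
    intro k
    induction k with
    | zero => intro _ i h1 h2; simpa using hwin i h1 h2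
    | succ k ih =>
      intro hk i h1 h2
      obtain ⟨j, rfl⟩ : ∃ j, i = j + 1 := ⟨i - 1, by omega⟩
      have e1 : (m - 1) * (k + 1) + (j + 1) = (m - 1) * k + j + m := by
        rw [Nat.mul_succ]; omega
      rw [e1, pow_add, ha, mul_add, mul_smul_comm, mul_smul_comm, ← pow_succ, mul_one, map_add,
        map_smul, map_smul, add_assoc, ih (by omega) (j + 1) (by omega) h2,
        ih (by omega) j (by omega) (by omega)]
      simp
  set L := (m - 1) * (n - 2) + e with hL
  have hexp : L + 1 ≤ matrixExponent K A := by
    have hmem := Nat.sInf_mem (⟨_, Nat.succ_pos _, hpos⟩ :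
      {p : ℕ | 0 < p ∧ IsKPositive K (A ^ p)}.Nonempty)
    by_contra! hlt
    have hE1 : E 1 ≠ 0 := by
      rw [Ne, LinearEquiv.map_eq_zero_iff]
      intro h
      have := map_one π
      rw [h, map_zero] at this
      exact zero_ne_one this
    have h1 := hprim.pow_mulVec_mem_interior_of_le (Nat.lt_succ_iff.1 hlt) (hmem.2 _ h1K hE1)
    rw [hApow, mul_one] at h1
    refine notMem_interior_of_functional hψ'K hψ'0 ?_ h1
    rw [hψ'E]
    exact hzero (n - 2) le_rfl e (by omega) le_rfl
  have hcone : ((L + 1 : ℕ) : ℕ∞) ≤ coneExponent K :=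
    le_trans (by exact_mod_cast hexp) (le_iSup₂_of_le A hprim le_rfl)
  refine ⟨K, ⟨hproper, ?_⟩, hcone⟩
  have hle := encard_extremeRays_le (K := K) (X := v) generator_mem
    (fun i h => by have := hπv i; rw [h, map_zero] at this; exact lt_irrefl _ this)
    (fun y hy => hy)
  rw [Fintype.card_fin] at hle
  obtain ⟨m', hm'⟩ := ENat.ne_top_iff_exists.1 (ne_top_of_le_ne_top (ENat.natCast_ne_top m) hle)
  rw [← hm'] at hle ⊢
  have hle' : m' ≤ m := by exact_mod_cast hle
  -- Fewer than `m` extreme rays would push the upper bound below the exponent just found; `m ≤ e +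
  -- 2` and `3 ≤ n` give the strict gap.
  have hup : L + 1 ≤ (n - 1) * (m' - 1) + 1 := by
    exact_mod_cast hcone.trans (coneExponent_le (by omega) hproper hm'.symm)
  have : m' = m := by
    by_contra hne'
    obtain ⟨b, rfl⟩ : ∃ b, n = b + 2 := ⟨n - 2, by omega⟩
    obtain ⟨c, rfl⟩ : ∃ c, m = c + 2 := ⟨m - 2, by omega⟩
    have h1 : (b + 2 - 1) * (m' - 1) ≤ (b + 2 - 1) * c := Nat.mul_le_mul_left _ (by omega)
    have e1 : b + 2 - 1 = b + 1 := rfl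
    have e2 : c + 2 - 1 = c + 1 := rfl
    have e3 : b + 2 - 2 = b := rfl
    rw [e1] at h1 hup
    rw [hL, e2, e3] at hup
    nlinarith
  rw [this]

end CyclicCones

/-! ### Perturbing roots of unity and window functionals -/

section Perturbation

open Filter Topology

variable {R : Type*} [NormedCommRing R] [NormedAlgebra ℝ R]

/-- Simple roots of `x ^ m = s x + t` depend continuously on `s` and `t`. -/
theorem eventually_exists_trinomial_root [FiniteDimensional ℝ R] {m : ℕ} {a₀ : R} {s₀ t₀ : ℝ}
    (h : a₀ ^ m = s₀ • a₀ + t₀ • 1) (hu : IsUnit ((m : R) * a₀ ^ (m - 1) - s₀ • 1))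
    {U : Set R} (hU : U ∈ 𝓝 a₀) :
    ∀ᶠ p : ℝ × ℝ in 𝓝 (s₀, t₀), ∃ a ∈ U, a ^ m = p.1 • a + p.2 • 1 := by
  have : CompleteSpace R := FiniteDimensional.complete ℝ R
  -- Carrying `s` along as a second coordinate turns solvability for all nearby `(s, t)` into local
  -- openness of one map, whose derivative is onto since `m a₀ ^ (m - 1) - s₀` is a unit.
  set f : R × ℝ → R × ℝ := fun q => (q.1 ^ m - q.2 • q.1, q.2) with hf
  have h1 : HasStrictFDerivAt (fun q : R × ℝ => q.1) (ContinuousLinearMap.fst ℝ R ℝ) (a₀, s₀) :=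
    hasStrictFDerivAt_fst
  have h2 : HasStrictFDerivAt (fun q : R × ℝ => q.2) (ContinuousLinearMap.snd ℝ R ℝ) (a₀, s₀) :=
    hasStrictFDerivAt_snd
  have hd : HasStrictFDerivAt f
      (((m • a₀ ^ (m - 1)) • ContinuousLinearMap.fst ℝ R ℝ - (s₀ • ContinuousLinearMap.fst ℝ R ℝ +
        (ContinuousLinearMap.snd ℝ R ℝ).smulRight a₀)).prod (ContinuousLinearMap.snd ℝ R ℝ))
      (a₀, s₀) := ((h1.pow m).sub (h2.smul h1)).prodMk h2
  have hmap := hd.map_nhds_eq_of_surj (by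
    rw [LinearMap.range_eq_top]
    rintro ⟨y, k⟩
    obtain ⟨c, hc⟩ := hu.exists_right_inv
    refine ⟨(c * (y + k • a₀), k), ?_⟩
    have key : (m : R) * a₀ ^ (m - 1) * (c * (y + k • a₀)) - s₀ • (c * (y + k • a₀))
        = y + k • a₀ := by
      simp only [Algebra.smul_def] at hc ⊢
      linear_combination (y + algebraMap ℝ R k * a₀) * hc
    refine Prod.ext ?_ rfl
    simp only [ContinuousLinearMap.prod_apply, _root_.sub_apply,
      _root_.add_apply, _root_.smul_apply, ContinuousLinearMap.coe_coe,
      ContinuousLinearMap.smulRight_apply, ContinuousLinearMap.coe_fst', ContinuousLinearMap.coe_snd',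
      smul_eq_mul, nsmul_eq_mul]
    rw [← sub_sub, key, add_sub_cancel_right])
  have hfa : f (a₀, s₀) = (t₀ • 1, s₀) := by
    rw [hf]; simp [h]
  have himg : f '' (U ×ˢ Set.univ) ∈ 𝓝 ((t₀ • 1, s₀) : R × ℝ) := by
    rw [← hfa, ← hmap]
    exact image_mem_map (by rw [nhds_prod_eq]; exact prod_mem_prod hU univ_mem)
  have hcont : Tendsto (fun p : ℝ × ℝ => ((p.2 • 1, p.1) : R × ℝ)) (𝓝 (s₀, t₀))
      (𝓝 (t₀ • 1, s₀)) := by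
    have : Continuous fun p : ℝ × ℝ => ((p.2 • 1, p.1) : R × ℝ) := by fun_prop
    exact this.tendsto (s₀, t₀)
  filter_upwards [hcont himg] with p hp
  obtain ⟨⟨a, s⟩, ⟨ha, -⟩, he⟩ := hp
  simp only [hf, Prod.mk.injEq] at he
  refine ⟨a, ha, ?_⟩
  rw [← he.1, ← he.2]
  abel

/-- The sequence `u` is positive on `[0, M - n]` and vanishes on `[M - n + 1, M - 1]`. -/
structure IsWindowPattern (u : ℕ → ℝ) (M n : ℕ) : Prop where
  pos : ∀ i, i + n ≤ M → 0 < u i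
  zero : ∀ i, M < i + n → i < M → u i = 0

theorem linearIndependent_pow_of_window {n M : ℕ} (hnM : n ≤ M) {a₀ : R}
    (haM : a₀ ^ M = 1) {φ : R →ₗ[ℝ] ℝ} (hφ : IsWindowPattern (fun i => φ (a₀ ^ i)) M n) :
    LinearIndependent ℝ fun k : Fin n => a₀ ^ (M - n + 1 + k : ℕ) := by
  rw [Fintype.linearIndependent_iff]
  intro g hg
  by_contra! hne
  classical
  obtain ⟨k, hk, hmax⟩ := Finset.exists_max_image (Finset.univ.filter fun k => g k ≠ 0) id
    (by obtain ⟨k, hk⟩ := hne; exact ⟨k, by simpa using hk⟩)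
  simp only [Finset.mem_filter, Finset.mem_univ, true_and, id] at hk hmax
  -- This factor moves the top surviving term to `a₀ ^ M = 1`, where `φ` is positive, and the lower
  -- ones into the window, where `φ` vanishes.
  have h1 := congrArg (fun y => φ (a₀ ^ (n - 1 - k : ℕ) * y)) hg
  simp only [Finset.mul_sum, mul_smul_comm, ← pow_add, map_sum, map_smul, smul_eq_mul, mul_zero,
    map_zero] at h1
  rw [Finset.sum_eq_single k] at h1
  · have e : n - 1 - k + (M - n + 1 + k : ℕ) = M := by omega
    rw [e, haM, ← pow_zero a₀] at h1
    exact (mul_ne_zero hk (hφ.pos 0 (by omega)).ne') h1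
  · intro j _ hj
    by_cases hgj : g j = 0
    · rw [hgj, zero_mul]
    · have : j < k := lt_of_le_of_ne (hmax j hgj) hj
      have hjk : (j : ℕ) < k := this
      rw [hφ.zero _ (by omega) (by omega), mul_zero]
  · simp

/-- A functional with a window pattern on the powers of `a₀` deforms to nearby elements. -/
theorem eventually_exists_window_functional [FiniteDimensional ℝ R] {n M : ℕ} (hn : 0 < n) (hnM : n ≤ M)
    (hR : Module.finrank ℝ R = n) {a₀ : R} (haM : a₀ ^ M = 1) {φ : R →ₗ[ℝ] ℝ}
    (hφ : IsWindowPattern (fun i => φ (a₀ ^ i)) M n) :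
    ∀ᶠ a in 𝓝 a₀, Submodule.span ℝ ((fun i => a ^ i) '' Set.Iio (M + 1)) = ⊤ ∧
      ∃ ψ : R →ₗ[ℝ] ℝ, IsWindowPattern (fun i => ψ (a ^ i)) M n ∧ ψ 1 < 2 * ψ (a ^ M) := by
  set E : R ≃ₗ[ℝ] (Fin n → ℝ) := LinearEquiv.ofFinrankEq R (Fin n → ℝ) (by simp [hR])
  have hE : Continuous E := E.toLinearMap.continuous_of_finiteDimensional
  set T : R → Matrix (Fin n) (Fin n) ℝ := fun a k => E (a ^ (M - n + 1 + k : ℕ)) with hT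
  set l : Fin n := ⟨n - 1, by omega⟩
  -- The determinant of `a ^ (M - n + 1), …, a ^ (M - 1), y` as a function of `y`: it vanishes on
  -- the window for every `a` and varies continuously with `a`.
  set D : R → R →ₗ[ℝ] ℝ := fun a =>
    (Matrix.detRowAlternating.toMultilinearMap.toLinearMap (T a) l) ∘ₗ E.toLinearMap with hD
  have hDdef : ∀ a y, D a y = Matrix.det (Function.update (T a) l (E y)) := fun a y => rfl
  have hTc : Continuous T := by
    refine continuous_pi fun k => ?_
    exact hE.comp (continuous_pow _)
  have hDc : ∀ i : ℕ, Continuous fun a => D a (a ^ i) := by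
    intro i
    simp_rw [hDdef]
    exact Continuous.matrix_det (hTc.update l (hE.comp (continuous_pow i)))
  have hDzero : ∀ a i, M < i + n → i < M → D a (a ^ i) = 0 := by
    intro a i h1 h2
    have e : E (a ^ i) = T a ⟨i - (M - n + 1), by omega⟩ := by
      rw [hT]
      simp only
      rw [Nat.add_sub_cancel' (by omega)]
    rw [hDdef, e]
    exact Matrix.detRowAlternating.map_update_self (T a) (i := l) (by
      intro h
      have := congrArg Fin.val h
      simp only [l] at this
      omega)
  have hDM : ∀ a, D a (a ^ M) = (T a).det := by
    intro a
    have e : E (a ^ M) = T a l := by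
      rw [hT]
      simp only [l]
      congr 2
      omega
    rw [hDdef, e, Function.update_eq_self]
  have hli := linearIndependent_pow_of_window hnM haM hφ
  have hdet : ∀ a, (LinearIndependent ℝ fun k : Fin n => a ^ (M - n + 1 + k : ℕ)) ↔
      (T a).det ≠ 0 := by
    intro a
    rw [← isUnit_iff_ne_zero, ← Matrix.isUnit_iff_isUnit_det,
      ← Matrix.linearIndependent_rows_iff_isUnit]
    exact (LinearMap.linearIndependent_iff E.toLinearMap E.ker).symm
  -- Multiplying by `d` later corrects the sign: at `a₀`, the functional `d • D a₀` is a positive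
  -- multiple of `φ`.
  set d := (T a₀).det with hd
  have hd0 : d ≠ 0 := (hdet a₀).1 hli
  have hφ1 : 0 < φ 1 := by simpa using hφ.pos 0 (by omega)
  have hprop : (φ 1) • D a₀ = d • φ := by
    have : Nonempty (Fin n) := ⟨l⟩
    refine (basisOfLinearIndependentOfCardEqFinrank hli (by simp [hR])).ext fun k => ?_
    rw [coe_basisOfLinearIndependentOfCardEqFinrank]
    simp only [LinearMap.smul_apply, smul_eq_mul]
    rcases Nat.lt_or_ge (M - n + 1 + k) M with h | h
    · rw [hDzero _ _ (by omega) h, hφ.zero _ (by omega) h]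
      simp
    · rw [show M - n + 1 + (k : ℕ) = M by omega, hDM, haM, mul_comm]
  have hval : ∀ y, φ 1 * (d * D a₀ y) = d ^ 2 * φ y := by
    intro y
    have := LinearMap.congr_fun hprop y
    simp only [LinearMap.smul_apply, smul_eq_mul] at this
    linear_combination d * this
  have hev1 : ∀ i, i + n ≤ M → ∀ᶠ a in 𝓝 a₀, 0 < d * D a (a ^ i) := by
    intro i hi
    refine (isOpen_lt continuous_const (continuous_const.mul (hDc i))).mem_nhds ?_
    have h1 := hval (a₀ ^ i)
    have h2 : 0 < d ^ 2 * φ (a₀ ^ i) := mul_pos (by positivity) (hφ.pos i hi)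
    rw [← h1] at h2
    exact pos_of_mul_pos_right h2 hφ1.le
  have hev2 : ∀ᶠ a in 𝓝 a₀, d * D a (a ^ 0) < 2 * (d * D a (a ^ M)) := by
    refine (isOpen_lt (continuous_const.mul (hDc 0))
      (continuous_const.mul (continuous_const.mul (hDc M)))).mem_nhds ?_
    have := (hev1 0 (by omega)).self_of_nhds
    show d * D a₀ (a₀ ^ 0) < 2 * (d * D a₀ (a₀ ^ M))
    rw [haM, ← pow_zero a₀]
    linarith
  have hev3 : ∀ᶠ a in 𝓝 a₀, (T a).det ≠ 0 := by
    have hc : Continuous fun a => (T a).det := hTc.matrix_det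
    exact hc.continuousAt.eventually_ne hd0
  have hev4 : ∀ᶠ a in 𝓝 a₀, ∀ i ∈ Finset.range (M - n + 1), 0 < d * D a (a ^ i) := by
    rw [Filter.eventually_all_finset]
    intro i hi
    exact hev1 i (by have := Finset.mem_range.1 hi; omega)
  filter_upwards [hev2, hev3, hev4] with a h2 h3 h4
  refine ⟨?_, d • D a, ⟨fun i hi => ?_, fun i h5 h6 => ?_⟩, ?_⟩
  · have hspan := ((hdet a).2 h3).span_eq_top_of_card_eq_finrank' (by simp [hR])
    rw [eq_top_iff, ← hspan]
    refine Submodule.span_mono ?_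
    rintro _ ⟨k, rfl⟩
    exact ⟨M - n + 1 + k, by simp only [Set.mem_Iio]; omega, rfl⟩
  · exact h4 i (by rw [Finset.mem_range]; omega)
  · simp [hDzero a i h5 h6]
  · simpa using h2

variable [FiniteDimensional ℝ R] {n M : ℕ} {a₀ : R} {φ : R →ₗ[ℝ] ℝ}

/-- A window pattern of order `n` and period `M` gives a cone with `M` extreme rays. -/
theorem exists_cone_of_window (hn : 3 ≤ n) (hnM : n ≤ M) (hR : Module.finrank ℝ R = n)
    (haM : a₀ ^ M = 1) (hφ : IsWindowPattern (fun i => φ (a₀ ^ i)) M n) (π : R →ₐ[ℝ] ℝ)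
    (hπ : 0 < π a₀) :
    ∃ K ∈ polyhedralCones M n, (((n - 1) * (M - 1) + 1 : ℕ) : ℕ∞) ≤ coneExponent K := by
  have hπc : Continuous π := π.toLinearMap.continuous_of_finiteDimensional
  have hev := (eventually_exists_window_functional (by omega) hnM hR haM hφ).and
    (hπc.continuousAt.eventually_const_lt hπ)
  have hunit : IsUnit ((M : R) * a₀ ^ (M - 1) - (0 : ℝ) • 1) := by
    rw [zero_smul, sub_zero]
    refine IsUnit.mul ?_ ((IsUnit.of_pow_eq_one haM (by omega)).pow _)
    rw [← map_natCast (algebraMap ℝ R)]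
    exact (isUnit_iff_ne_zero.2 (Nat.cast_ne_zero.2 (by omega))).map _
  have hroot := eventually_exists_trinomial_root (t₀ := 1) (by simp [haM]) hunit hev
  have hlim : Tendsto (fun ε : ℝ => (ε, (1 : ℝ))) (𝓝[>] 0) (𝓝 (0, 1)) := by
    have : Continuous fun ε : ℝ => (ε, (1 : ℝ)) := by fun_prop
    exact (this.tendsto 0).mono_left nhdsWithin_le_nhds
  obtain ⟨ε, ⟨a, ⟨⟨hspan, ψ, hψ, -⟩, hπa⟩, ha⟩, hε⟩ :=
    ((hlim.eventually hroot).and self_mem_nhdsWithin).exists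
  have hψ1 : 0 < ψ 1 := by simpa using hψ.pos 0 (by omega)
  have hψnn : ∀ i, i < M → 0 ≤ ψ (a ^ i) := fun i hi => by
    rcases Nat.lt_or_ge M (i + n) with h | h
    · exact (hψ.zero i h hi).ge
    · exact (hψ.pos i h).le
  have hspan' : Submodule.span ℝ ((fun i => a ^ i) '' Set.Iio M) = ⊤ := by
    rw [eq_top_iff, ← hspan, Submodule.span_le]
    have hmem : ∀ i, i < M → a ^ i ∈ Submodule.span ℝ ((fun i => a ^ i) '' Set.Iio M) :=
      fun i hi => Submodule.subset_span ⟨i, hi, rfl⟩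
    rintro _ ⟨i, hi, rfl⟩
    rcases Nat.lt_or_ge i M with h | h
    · exact hmem i h
    · have : i = M := le_antisymm (Nat.lt_succ_iff.1 hi) h
      simp only [this, ha]
      refine Submodule.add_mem _ (Submodule.smul_mem _ _ ?_) (Submodule.smul_mem _ _ ?_)
      · simpa using hmem 1 (by omega)
      · simpa using hmem 0 (by omega)
  -- The equation is `a ^ M = ε a + 1`, with `γ = 0`: the generators are plain powers.
  obtain ⟨K, hK, hle⟩ := exists_cone_of_cyclic (e := M - 1) hn (by omega) hR a one_pos hε le_rfl
    (le_of_lt hε) ha π hπa ψ (fun h => by simp [h] at hψ1) (fun i hi => hψnn i (by omega))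
    (by simpa using hψnn (M - 1) (by omega)) (fun i h1 h2 => hψ.zero i (by omega) (by omega))
    (by omega) (by omega) hspan'
  refine ⟨K, hK, ?_⟩
  convert hle using 2
  obtain ⟨b, rfl⟩ : ∃ b, n = b + 2 := ⟨n - 2, by omega⟩
  rw [show b + 2 - 1 = b + 1 from rfl, show b + 2 - 2 = b from rfl]
  ring

/-- A window pattern of order `n` and period `M` gives a cone with `M + 1` extreme rays. -/
theorem exists_cone_succ_of_window (hn : 3 ≤ n) (hnM : n ≤ M) (hR : Module.finrank ℝ R = n)
    (haM : a₀ ^ M = 1) (hφ : IsWindowPattern (fun i => φ (a₀ ^ i)) M n) (π : R →ₐ[ℝ] ℝ)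
    (hπ : 0 < π a₀) :
    ∃ K ∈ polyhedralCones (M + 1) n, (((n - 1) * M : ℕ) : ℕ∞) ≤ coneExponent K := by
  have hπc : Continuous π := π.toLinearMap.continuous_of_finiteDimensional
  have hev := (eventually_exists_window_functional (by omega) hnM hR haM hφ).and
    (hπc.continuousAt.eventually_const_lt hπ)
  have hunit : IsUnit (((M + 1 : ℕ) : R) * a₀ ^ (M + 1 - 1) - (1 : ℝ) • 1) := by
    rw [Nat.add_sub_cancel, haM, one_smul, Nat.cast_succ, mul_one, add_sub_cancel_right,
      ← map_natCast (algebraMap ℝ R)]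
    exact (isUnit_iff_ne_zero.2 (Nat.cast_ne_zero.2 (by omega))).map _
  have hroot := eventually_exists_trinomial_root (t₀ := 0) (by simp [pow_succ, haM]) hunit hev
  have hlim : Tendsto (fun ε : ℝ => ((1 : ℝ), ε)) (𝓝[>] 0) (𝓝 (1, 0)) := by
    have : Continuous fun ε : ℝ => ((1 : ℝ), ε) := by fun_prop
    exact (this.tendsto 0).mono_left nhdsWithin_le_nhds
  obtain ⟨ε, ⟨a, ⟨⟨hspan, ψ, hψ, hψM⟩, hπa⟩, ha⟩, hε⟩ :=
    ((hlim.eventually hroot).and self_mem_nhdsWithin).exists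
  have hψ1 : 0 < ψ 1 := by simpa using hψ.pos 0 (by omega)
  -- The equation is `a ^ (M + 1) = a + ε`. Since `a₀ ^ M = 1`, the condition on the last generator
  -- with `γ = 1 / 2` holds strictly at `a₀` and survives the perturbation.
  obtain ⟨K, hK, hle⟩ := exists_cone_of_cyclic (e := M - 1) (γ := 1 / 2) hn (by omega) hR a hε
    one_pos (by norm_num) (by norm_num) ha π hπa ψ (fun h => by simp [h] at hψ1)
    (fun i hi => by
      rcases Nat.lt_or_ge M (i + n) with h | h
      · exact (hψ.zero i h (by omega)).ge
      · exact (hψ.pos i h).le)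
    (by rw [Nat.add_sub_cancel]; linarith) (fun i h1 h2 => hψ.zero i (by omega) (by omega))
    (by omega) (by omega) hspan
  refine ⟨K, hK, ?_⟩
  convert hle using 2
  obtain ⟨b, rfl⟩ : ∃ b, n = b + 2 := ⟨n - 2, by omega⟩
  obtain ⟨c, rfl⟩ : ∃ c, M = c + 1 := ⟨M - 1, by omega⟩
  rw [show b + 2 - 1 = b + 1 from rfl, show b + 2 - 2 = b from rfl, Nat.add_sub_cancel,
    Nat.add_sub_cancel]
  ring

end Perturbation

/-! ### Trigonometric polynomials as functionals on the moment curve -/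

section TrigPolynomials

open Complex

/-- Real trigonometric polynomials of degree at most `r`. -/
def trigPolynomials (r : ℕ) : Submodule ℝ (ℝ → ℝ) :=
  Submodule.span ℝ {f | ∃ (k : ℤ) (c : ℂ), |k| ≤ r ∧ f = fun θ : ℝ => (c * exp (k * θ * I)).re}

/-- A single half-angle sine is not a trigonometric polynomial in `θ`, but a product of two is `(cos
(b - b') - cos (θ + b + b')) / 2`, of degree one. -/
theorem mul_mem_trigPolynomials {r : ℕ} {f : ℝ → ℝ} (hf : f ∈ trigPolynomials r) (b b' : ℝ) :
    (fun θ => f θ * (Real.sin (θ / 2 + b) * Real.sin (θ / 2 + b'))) ∈ trigPolynomials (r + 1) := by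
  set q : ℂ := exp ((b + b') * I)
  have hg : ∀ θ : ℝ, Real.sin (θ / 2 + b) * Real.sin (θ / 2 + b') =
      Real.cos (b - b') / 2 - (q * exp (θ * I)).re / 2 := by
    intro θ
    have h1 : (q * exp (θ * I)).re = Real.cos (θ + b + b') := by
      rw [← Complex.exp_add, ← Complex.exp_ofReal_mul_I_re]
      congr 2
      push_cast
      ring
    rw [h1, show θ + b + b' = (θ / 2 + b) + (θ / 2 + b') by ring,
      show b - b' = (θ / 2 + b) - (θ / 2 + b') by ring, Real.cos_add, Real.cos_sub]
    ring
  simp_rw [hg]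
  induction hf using Submodule.span_induction with
  | mem f hf =>
    obtain ⟨k, c, hk, rfl⟩ := hf
    have hk' := abs_le.1 hk
    have hmem : ∀ (j : ℤ) (d : ℂ), |j| ≤ r + 1 →
        (fun θ : ℝ => (d * exp (j * θ * I)).re) ∈ trigPolynomials (r + 1) :=
      fun j d hj => Submodule.subset_span ⟨j, d, by exact_mod_cast hj, rfl⟩
    have h1 := hmem k c (by omega)
    have h2 := hmem (k + 1) (c * q) (by rw [abs_le]; omega)
    have h3 := hmem (k - 1) (c * (starRingEnd ℂ) q) (by rw [abs_le]; omega)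
    have h4 := Submodule.sub_mem _ (Submodule.smul_mem _ (Real.cos (b - b') / 2) h1)
      (Submodule.add_mem _ (Submodule.smul_mem _ (1 / 4 : ℝ) h2) (Submodule.smul_mem _ (1 / 4 : ℝ) h3))
    convert h4 using 1
    ext θ
    have e2 : exp ((k + 1 : ℤ) * θ * I) = exp (k * θ * I) * exp (θ * I) := by
      rw [← Complex.exp_add]; congr 1; push_cast; ring
    have e3 : exp ((k - 1 : ℤ) * θ * I) = exp (k * θ * I) * (starRingEnd ℂ) (exp (θ * I)) := by
      rw [← Complex.exp_conj, ← Complex.exp_add]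
      congr 1
      simp
      ring
    simp only [Pi.sub_apply, Pi.add_apply, Pi.smul_apply, smul_eq_mul]
    rw [e2, e3]
    generalize exp (k * θ * I) = z
    generalize exp (θ * I) = w
    simp only [Complex.mul_re, Complex.mul_im, Complex.conj_re, Complex.conj_im]
    ring
  | zero =>
    convert Submodule.zero_mem (trigPolynomials (r + 1)) using 1
    ext θ
    simp
  | add f g _ _ hf hg =>
    convert Submodule.add_mem _ hf hg using 1
    ext θ
    simp only [Pi.add_apply]
    ring
  | smul c f _ hf =>
    convert Submodule.smul_mem _ c hf using 1
    ext θ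
    simp only [Pi.smul_apply, smul_eq_mul]
    ring

theorem prod_sin_mem_trigPolynomials (b : ℕ → ℝ) (r : ℕ) :
    (fun θ => ∏ l ∈ Finset.range (2 * r), Real.sin (θ / 2 + b l)) ∈ trigPolynomials r := by
  induction r with
  | zero =>
    refine Submodule.subset_span ⟨0, 1, by simp, ?_⟩
    ext θ
    simp
  | succ r ih =>
    have := mul_mem_trigPolynomials ih (b (2 * r)) (b (2 * r + 1))
    convert this using 2
    rw [show 2 * (r + 1) = 2 * r + 1 + 1 by ring, Finset.prod_range_succ, Finset.prod_range_succ,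
      mul_assoc]

/-- The point `(1, exp (i θ), …, exp (i r θ))` of the trigonometric moment curve. -/
noncomputable def trigPoint (r : ℕ) (θ : ℝ) : ℝ × (Fin r → ℂ) :=
  (1, fun j => exp (((j : ℕ) + 1 : ℂ) * θ * I))

theorem trigPoint_pow (r : ℕ) (θ : ℝ) (i : ℕ) : trigPoint r θ ^ i = trigPoint r (i * θ) := by
  refine Prod.ext (by simp [trigPoint]) ?_
  ext j
  simp only [trigPoint, Prod.pow_snd, Pi.pow_apply, ← Complex.exp_nat_mul]
  congr 1
  push_cast
  ring

theorem trigPoint_two_pi (r : ℕ) : trigPoint r (2 * Real.pi) = 1 := by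
  refine Prod.ext rfl ?_
  ext j
  simp only [trigPoint, Prod.snd_one, Pi.one_apply]
  convert Complex.exp_nat_mul_two_pi_mul_I ((j : ℕ) + 1) using 2
  push_cast
  ring

theorem exists_functional_of_mem_trigPolynomials {r : ℕ} {f : ℝ → ℝ}
    (hf : f ∈ trigPolynomials r) :
    ∃ φ : ℝ × (Fin r → ℂ) →ₗ[ℝ] ℝ, ∀ θ, φ (trigPoint r θ) = f θ := by
  induction hf using Submodule.span_induction with
  | zero => exact ⟨0, fun θ => rfl⟩
  | add f g _ _ hf hg =>
    obtain ⟨φ, hφ⟩ := hf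
    obtain ⟨χ, hχ⟩ := hg
    exact ⟨φ + χ, fun θ => by simp [hφ, hχ]⟩
  | smul c f _ hf =>
    obtain ⟨φ, hφ⟩ := hf
    exact ⟨c • φ, fun θ => by simp [hφ]⟩
  | mem f hf =>
    obtain ⟨k, c, hk, rfl⟩ := hf
    have key : ∀ (j : Fin r) (d : ℂ), ∃ φ : ℝ × (Fin r → ℂ) →ₗ[ℝ] ℝ, ∀ θ : ℝ,
        φ (trigPoint r θ) = (d * exp (((j : ℕ) + 1 : ℂ) * θ * I)).re := fun j d =>
      ⟨Complex.reLm ∘ₗ LinearMap.mulLeft ℝ d ∘ₗ LinearMap.proj j ∘ₗ LinearMap.snd ℝ ℝ (Fin r → ℂ),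
        fun θ => rfl⟩
    have hk' := abs_le.1 hk
    rcases lt_trichotomy k 0 with h | rfl | h
    · obtain ⟨φ, hφ⟩ := key ⟨(-k - 1).toNat, by omega⟩ ((starRingEnd ℂ) c)
      refine ⟨φ, fun θ => ?_⟩
      rw [hφ, ← Complex.conj_re, map_mul, Complex.conj_conj, ← Complex.exp_conj]
      have e : (((-k - 1).toNat : ℕ) : ℂ) + 1 = -(k : ℂ) := by
        have : (((-k - 1).toNat : ℕ) : ℤ) + 1 = -k := by omega
        exact_mod_cast congrArg (Int.cast (R := ℂ)) this
      simp only [e]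
      simp
    · exact ⟨c.re • LinearMap.fst ℝ ℝ (Fin r → ℂ), fun θ => by simp [trigPoint]⟩
    · obtain ⟨φ, hφ⟩ := key ⟨(k - 1).toNat, by omega⟩ c
      refine ⟨φ, fun θ => ?_⟩
      have e : (((k - 1).toNat : ℕ) : ℂ) + 1 = (k : ℂ) := by
        have : (((k - 1).toNat : ℕ) : ℤ) + 1 = k := by omega
        exact_mod_cast congrArg (Int.cast (R := ℂ)) this
      rw [hφ]
      simp only [e]

end TrigPolynomials

/-! ### Sign patterns from products of sines -/

section Windows

/-- The product of the values `sin (π (i + l) / M)` for `1 ≤ l ≤ 2 r`. -/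
noncomputable def sinWindow (M r i : ℕ) : ℝ :=
  ∏ l ∈ Finset.range (2 * r), Real.sin (Real.pi * (i + l + 1 : ℕ) / M)

theorem sin_pi_mul_div_pos {M j : ℕ} (hj : 0 < j) (hjM : j < M) :
    0 < Real.sin (Real.pi * j / M) := by
  have hM : (0 : ℝ) < M := by exact_mod_cast hj.trans hjM
  have hj' : (0 : ℝ) < j := by exact_mod_cast hj
  refine Real.sin_pos_of_pos_of_lt_pi (by positivity) ?_
  rw [div_lt_iff₀ hM]
  exact mul_lt_mul_of_pos_left (by exact_mod_cast hjM) Real.pi_pos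

theorem sinWindow_isWindowPattern (M r : ℕ) :
    IsWindowPattern (sinWindow M r) M (2 * r + 1) where
  pos i hi := Finset.prod_pos fun l hl => by
    have := Finset.mem_range.1 hl
    exact sin_pi_mul_div_pos (by omega) (by omega)
  zero i h1 h2 := by
    refine Finset.prod_eq_zero (i := M - i - 1) (Finset.mem_range.2 (by omega)) ?_
    rw [show i + (M - i - 1) + 1 = M by omega, mul_div_assoc,
      div_self (Nat.cast_ne_zero.2 (by omega : M ≠ 0)), mul_one, Real.sin_pi]

theorem sinWindow_symm {M r i : ℕ} (h : i + 2 * r < M) :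
    sinWindow M r (M - 2 * r - 1 - i) = sinWindow M r i := by
  rw [sinWindow, ← Finset.prod_range_reflect]
  refine Finset.prod_congr rfl fun l hl => ?_
  have hl' := Finset.mem_range.1 hl
  have hM : (M : ℝ) ≠ 0 := by exact_mod_cast (by omega : M ≠ 0)
  rw [← Real.sin_pi_sub]
  congr 1
  have e : ((M - 2 * r - 1 - i + (2 * r - 1 - l) + 1 : ℕ) : ℝ) = M - (i + l + 1 : ℕ) := by
    rw [← Nat.cast_sub (by omega)]
    congr 1
    omega
  rw [e]
  field_simp
  ring

/-- Passing to `i + 1` only replaces the factor `sin (π (i + 1) / M)` by `sin (π (i + 2 r + 1) /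
M)`, which is larger while the mean of the two angles is below `π / 2`. -/
theorem sinWindow_lt_succ {M r i : ℕ} (hr : 0 < r) (h : 2 * i + 2 + 2 * r < M) :
    sinWindow M r i < sinWindow M r (i + 1) := by
  obtain ⟨q, rfl⟩ : ∃ q, r = q + 1 := ⟨r - 1, by omega⟩
  rw [sinWindow, sinWindow, show 2 * (q + 1) = 2 * q + 1 + 1 by ring, Finset.prod_range_succ',
    Finset.prod_range_succ _ (2 * q + 1)]
  have e : ∀ l, i + (l + 1) + 1 = i + 1 + l + 1 := fun l => by ring
  simp_rw [e]
  refine mul_lt_mul_of_pos_left ?_ ?_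
  · have hM : (0 : ℝ) < M := by exact_mod_cast (by omega : 0 < M)
    rw [← sub_pos, Real.sin_sub_sin]
    refine mul_pos (mul_pos two_pos ?_) ?_
    · have := sin_pi_mul_div_pos (M := M) (j := q + 1) (by omega) (by omega)
      refine this.trans_eq (congrArg Real.sin ?_)
      push_cast
      ring
    · refine Real.cos_pos_of_mem_Ioo ⟨?_, ?_⟩
      · refine lt_of_lt_of_le (neg_lt_zero.2 (by positivity)) ?_
        positivity
      · rw [← add_div, ← mul_add, div_div, div_lt_div_iff₀ (by positivity) two_pos, mul_assoc]
        refine mul_lt_mul_of_pos_left ?_ Real.pi_pos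
        have : i + 1 + (2 * q + 1) + 1 + (i + 0 + 1) < M := by omega
        have : ((i + 1 + (2 * q + 1) + 1 : ℕ) : ℝ) + (i + 0 + 1 : ℕ) < M := by exact_mod_cast this
        linarith
  · refine Finset.prod_pos fun l hl => ?_
    have := Finset.mem_range.1 hl
    exact sin_pi_mul_div_pos (by omega) (by omega)

/-- Positivity, in the first half, of a sequence with increasing consecutive sums. -/
theorem pos_of_add_succ_eq {u v : ℕ → ℝ} {L : ℕ} (hu0 : u 0 = 0)
    (huv : ∀ i, i < L → u i + u (i + 1) = v i) (hv0 : 0 < v 0)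
    (hv : ∀ i, 2 * i + 2 < L → v i < v (i + 1)) {k : ℕ} (hk : 0 < k) (hkL : 2 * k ≤ L) :
    0 < u k ∧ u k ≤ v (k - 1) := by
  induction k, hk using Nat.le_induction with
  | base =>
    have := huv 0 (by omega)
    rw [hu0, zero_add] at this
    rw [show Nat.succ 0 = 0 + 1 from rfl, this]
    exact ⟨hv0, le_rfl⟩
  | succ k hk ih =>
    obtain ⟨h1, h2⟩ := ih (by omega)
    obtain ⟨j, rfl⟩ : ∃ j, k = j + 1 := ⟨k - 1, by omega⟩
    have h3 := huv (j + 1) (by omega)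
    have h4 := hv j (by omega)
    rw [Nat.add_sub_cancel] at h2 ⊢
    constructor <;> linarith

theorem trigPoint_window_functional (M r : ℕ) :
    ∃ φ : ℝ × (Fin r → ℂ) →ₗ[ℝ] ℝ, ∀ i : ℕ,
      φ (trigPoint r (2 * Real.pi / M) ^ i) = sinWindow M r i := by
  obtain ⟨φ, hφ⟩ := exists_functional_of_mem_trigPolynomials
    (prod_sin_mem_trigPolynomials (fun l => Real.pi * (l + 1 : ℕ) / M) r)
  refine ⟨φ, fun i => ?_⟩
  rw [trigPoint_pow, hφ, sinWindow]
  refine Finset.prod_congr rfl fun l _ => ?_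
  congr 1
  push_cast
  ring

theorem trigPoint_pow_period {M : ℕ} (hM : 0 < M) (r : ℕ) :
    trigPoint r (2 * Real.pi / M) ^ M = 1 := by
  rw [trigPoint_pow, mul_div_cancel₀ _ (by exact_mod_cast hM.ne'), trigPoint_two_pi]

/-- No complex coordinate is `-1`, since its argument lies strictly between `0` and `π`. The inverse
serves to solve `w i + w (i + 1) = sinWindow M r i`. -/
theorem isUnit_trigPoint_add_one {M r : ℕ} (h : 2 * r < M) :
    IsUnit (trigPoint r (2 * Real.pi / M) + 1) := by
  rw [Prod.isUnit_iff, Pi.isUnit_iff]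
  refine ⟨isUnit_iff_ne_zero.2 (by simp [trigPoint]), fun j => isUnit_iff_ne_zero.2 ?_⟩
  intro h0
  have hM : (0 : ℝ) < M := by exact_mod_cast (by omega : 0 < M)
  have h1 := congrArg Complex.im h0
  have e : (trigPoint r (2 * Real.pi / M)).2 j =
      Complex.exp ((Real.pi * (2 * (j + 1) : ℕ) / M : ℝ) * Complex.I) := by
    simp only [trigPoint]
    congr 1
    push_cast
    ring
  simp only [Prod.snd_add, Pi.add_apply, Prod.snd_one, Pi.one_apply] at h1
  rw [e, Complex.add_im, Complex.exp_ofReal_mul_I_im] at h1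
  have := sin_pi_mul_div_pos (M := M) (j := 2 * (j + 1)) (by omega) (by omega)
  simp only [Complex.one_im, Complex.zero_im, add_zero] at h1
  exact this.ne' h1

/-- The functional data needed for the construction of cones of large exponent. -/
def HasWindowData (M n : ℕ) : Prop :=
  ∃ (R : Type) (_ : NormedCommRing R) (_ : NormedAlgebra ℝ R) (_ : FiniteDimensional ℝ R)
    (a : R) (φ : R →ₗ[ℝ] ℝ) (π : R →ₐ[ℝ] ℝ), Module.finrank ℝ R = n ∧ a ^ M = 1 ∧ 0 < π a ∧
      IsWindowPattern (fun i => φ (a ^ i)) M n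

theorem hasWindowData_odd {M r : ℕ} (hM : 0 < M) : HasWindowData M (2 * r + 1) := by
  obtain ⟨φ, hφ⟩ := trigPoint_window_functional M r
  refine ⟨ℝ × (Fin r → ℂ), inferInstance, inferInstance, inferInstance,
    trigPoint r (2 * Real.pi / M), φ, AlgHom.fst ℝ ℝ (Fin r → ℂ), ?_, trigPoint_pow_period hM r,
    ?_, ?_⟩
  · simp [Module.finrank_prod, Module.finrank_pi_fintype, Complex.finrank_real_complex]
    ring
  · simp [trigPoint]
  · simp_rw [hφ]
    exact sinWindow_isWindowPattern M r

/-- Summing adjacent terms removes the contribution of the coordinate `-1`. So one seeks `u` whose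
adjacent sums are the odd-dimensional window: this gains one zero, and positivity follows from
monotonicity up to the middle and reflection beyond it. -/
theorem hasWindowData_even {M r : ℕ} (hr : 0 < r) (hM : Even M) (hrM : 2 * r + 2 ≤ M) :
    HasWindowData M (2 * r + 2) := by
  have hM0 : 0 < M := by omega
  obtain ⟨φ, hφ⟩ := trigPoint_window_functional M r
  set a := trigPoint r (2 * Real.pi / M) with ha
  have haM : a ^ M = 1 := trigPoint_pow_period hM0 r
  obtain ⟨c, hc⟩ := (isUnit_trigPoint_add_one (M := M) (r := r) (by omega)).exists_right_inv
  rw [← ha] at hc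
  set w : ℕ → ℝ := fun i => φ (c * a ^ i) with hw
  have hwv : ∀ i, w i + w (i + 1) = sinWindow M r i := by
    intro i
    rw [hw, ← hφ i, ← map_add]
    congr 1
    linear_combination a ^ i * hc
  -- The alternating correction keeps the adjacent sums and forces `u 0 = 0`; as `M` is even, `u M =
  -- 0` too.
  set u : ℕ → ℝ := fun i => w i - (-1) ^ i * w 0 with hu
  have huv : ∀ i, u i + u (i + 1) = sinWindow M r i := by
    intro i
    rw [← hwv i, hu]
    simp only [pow_succ]
    ring
  have hu0 : u 0 = 0 := by simp [hu]
  have huM : u M = 0 := by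
    simp only [hu, hw, haM, hM.neg_one_pow, pow_zero]
    ring
  have hpat := sinWindow_isWindowPattern M r
  have huzero : ∀ k, k ≤ 2 * r → u (M - k) = 0 := by
    intro k
    induction k with
    | zero => intro _; simpa using huM
    | succ k ih =>
      intro hk
      have h1 := huv (M - (k + 1))
      rw [show M - (k + 1) + 1 = M - k by omega, ih (by omega),
        hpat.zero _ (by omega) (by omega)] at h1
      simpa using h1
  have hupos : ∀ k, 0 < k → k < M - 2 * r → 0 < u k := by
    intro k hk hkM
    have hv0 : 0 < sinWindow M r 0 := hpat.pos 0 (by omega)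
    have hv : ∀ i, 2 * i + 2 < M - 2 * r → sinWindow M r i < sinWindow M r (i + 1) :=
      fun i hi => sinWindow_lt_succ hr (by omega)
    rcases Nat.lt_or_ge (M - 2 * r) (2 * k) with h | h
    · have := (pos_of_add_succ_eq (u := fun i => u (M - 2 * r - i)) (v := sinWindow M r)
        (L := M - 2 * r) (by simpa using huzero (2 * r) le_rfl) (fun i hi => ?_) hv0 hv
        (k := M - 2 * r - k) (by omega) (by omega)).1
      · simpa only [show M - 2 * r - (M - 2 * r - k) = k by omega] using this
      · rw [← sinWindow_symm (by omega), ← huv, add_comm,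
          show M - 2 * r - (i + 1) = M - 2 * r - 1 - i by omega,
          show M - 2 * r - 1 - i + 1 = M - 2 * r - i by omega]
    · exact (pos_of_add_succ_eq hu0 (fun i _ => huv i) hv0 hv hk h).1
  -- The pattern is read from `u (i + 1)`, which skips the zero at `0`; hence the factor `c * a` and
  -- the sign `+` on `w 0`. The character is the coordinate where the element equals `1`.
  refine ⟨ℝ × ℝ × (Fin r → ℂ), inferInstance, inferInstance, inferInstance, (-1, a),
    (w 0 • LinearMap.id).coprod (φ ∘ₗ LinearMap.mulLeft ℝ (c * a)),
    (AlgHom.fst ℝ ℝ (Fin r → ℂ)).comp (AlgHom.snd ℝ ℝ _), ?_, ?_, ?_, ?_⟩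
  · simp [Module.finrank_prod, Module.finrank_pi_fintype, Complex.finrank_real_complex]
    ring
  · rw [Prod.pow_mk, haM, hM.neg_one_pow]
    rfl
  · simp [ha, trigPoint]
  · have e : ∀ i : ℕ, ((w 0 • LinearMap.id).coprod (φ ∘ₗ LinearMap.mulLeft ℝ (c * a)))
        (((-1, a) : ℝ × ℝ × (Fin r → ℂ)) ^ i) = u (i + 1) := by
      intro i
      rw [Prod.pow_mk, LinearMap.coprod_apply]
      simp only [LinearMap.comp_apply, LinearMap.smul_apply, LinearMap.id_apply,
        LinearMap.mulLeft_apply, smul_eq_mul, hu, hw]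
      rw [pow_succ', pow_succ, mul_assoc]
      ring
    simp_rw [e]
    refine ⟨fun i hi => hupos _ (by omega) (by omega), fun i h1 h2 => ?_⟩
    have := huzero (M - (i + 1)) (by omega)
    rwa [show M - (M - (i + 1)) = i + 1 by omega] at this

end Windows

/-! ### The maximum over all cones -/

theorem theorem7p1 (m n : ℕ) (hn : 3 ≤ n) (hnm : n ≤ m) :
    ∃ M : ℕ, IsGreatest {g : ℕ∞ | ∃ K ∈ polyhedralCones m n, g = coneExponent K} (M : ℕ∞) ∧
      ((Even m ∨ (Odd m ∧ Odd n)) → M = (n - 1) * (m - 1) + 1) ∧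
      ((Odd m ∧ Even n) →
        (n - 1) * (m - 1) ≤ M ∧ M ≤ (n - 1) * (m - 1) + 1) := by
  set N := (n - 1) * (m - 1) with hN
  have hub : ∀ K ∈ polyhedralCones m n, coneExponent K ≤ ((N + 1 : ℕ) : ℕ∞) :=
    fun K hK => coneExponent_le (by omega) hK.1 hK.2
  by_cases hmax : ∃ K ∈ polyhedralCones m n, ((N + 1 : ℕ) : ℕ∞) ≤ coneExponent K
  · obtain ⟨K, hK, hle⟩ := hmax
    refine ⟨N + 1, ⟨⟨K, hK, le_antisymm hle (hub K hK)⟩, ?_⟩, fun _ => rfl,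
      fun _ => ⟨Nat.le_succ _, le_rfl⟩⟩
    rintro _ ⟨K', hK', rfl⟩
    exact hub K' hK'
  · have hwin : ∀ k, HasWindowData m k → k = n → False := by
      rintro k ⟨R, _, _, _, a, φ, π, hR, haM, hπ, hφ⟩ rfl
      exact hmax (exists_cone_of_window hn hnm hR haM hφ π hπ)
    have hnodd : ¬ Odd n := fun ⟨r, hr⟩ => hwin _ (hasWindowData_odd (by omega)) hr.symm
    obtain ⟨r, hr⟩ : ∃ r, n = 2 * r + 2 := by
      obtain ⟨q, hq⟩ := Nat.not_odd_iff_even.1 hnodd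
      exact ⟨q - 1, by omega⟩
    have hmeven : ¬ Even m := fun h =>
      hwin _ (hasWindowData_even (r := r) (by omega) h (by omega)) hr.symm
    obtain ⟨q, hq⟩ := Nat.not_even_iff_odd.1 hmeven
    obtain ⟨R, _, _, _, a, φ, π, hR, haM, hπ, hφ⟩ :=
      hasWindowData_even (M := 2 * q) (r := r) (by omega) (by simp) (by omega)
    rw [← hr] at hR hφ
    obtain ⟨K, hK, hle⟩ := exists_cone_succ_of_window hn (by omega) hR haM hφ π hπ
    rw [← hq] at hK
    have hN' : N = (n - 1) * (2 * q) := by rw [hN, hq, Nat.add_sub_cancel]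
    rw [← hN'] at hle
    have hub' : ∀ K ∈ polyhedralCones m n, coneExponent K ≤ (N : ℕ∞) := by
      intro K' hK'
      have h1 : coneExponent K' < ((N + 1 : ℕ) : ℕ∞) :=
        not_le.1 fun h => hmax ⟨K', hK', h⟩
      exact Order.le_of_lt_add_one (by simpa using h1)
    refine ⟨N, ⟨⟨K, hK, le_antisymm hle (hub' K hK)⟩, ?_⟩, ?_, fun _ => ⟨le_rfl, Nat.le_succ _⟩⟩
    · rintro _ ⟨K', hK', rfl⟩
      exact hub' K' hK'
    · rintro (h | ⟨-, h⟩)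
      · exact absurd h hmeven
      · exact absurd h hnodd
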